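/- **Theorem 2 (BMA of Non-Nested Models).** Setting. There are $K\ge 1$ candidate models $M_1,\dots,M_K$. Let $\mathcal S$ be the set of all $\theta=(M_k,\beta_k)$, where $\beta_k$ ranges over the (measurable) parameter space of $M_k$, and let $Pr$ be a prior probability measure on $\mathcal S$. For each $\theta$ let $p_\theta(y|x)$ be a conditional density of the response with respect to a fixed $\sigma$-finite reference measure, jointly measurable in $(\theta,x,y)$. Covariates have a distribution $p_0(dx)$, and $P_\theta=p_0(dx)\,p_\theta(y|x)\,dy$. Let $\theta_0\in\mathcal S$ be the true parameter, belonging to the model $M_1$; write $p_0(y|x)=p_{\theta_0}(y|x)$, $P_0=P_{\theta_0}$, and let $P_0^N$ be the law of $N$ i.i.d. observations $(X,Y)=((X_1,Y_1),\dots,(X_N,Y_N))$ from $P_0$. Let $Pr(\cdot|X,Y)$ be the posterior on $\mathcal S$ given by Bayes' formula, and $Pr(M_k|X,Y)$ the posterior probability of $M_k$. The Hellinger distance is $d_H(P,Q)=\big(\tfrac12\int(\sqrt p-\sqrt q)^2\big)^{1/2}$, and likewise $\big(\tfrac12\sum_k(\sqrt{p_k}-\sqrt{q_k})^2\big)^{1/2}$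 for probability vectors; $d_E$ is the Euclidean distance; $\mathcal D(r,\mathcal P,d)$ is the maximal number of points of $\mathcal P$ with pairwise distances at least $r$. There is a universal constant $L>0$ such that the following holds. Suppose there are $\varepsilon_N>0$ with $\varepsilon_N\to0$ and $N\varepsilon_N^2\to\infty$, a constant $C>0$ and sets $\mathcal S_N\subseteq\mathcal S$ such that, for all sufficiently large $N$, 1. $\log\mathcal D(\varepsilon_N/2,\{P_\theta:\theta\in\mathcal S_N\},d_H)\le N\varepsilon_N^2$; 2. $Pr(\mathcal S\setminus\mathcal S_N)\le e^{-N\varepsilon_N^2(C+4)}$; 3. $Pr\Big(\theta:\ -P_0\log\frac{p_\theta(Y_1|X_1)}{p_0(Y_1|X_1)}\le\varepsilon_N^2,\ P_0\Big(\log\frac{p_\theta(Y_1|X_1)}{p_0(Y_1|X_1)}\Big)^2\le\varepsilon_N^2\Big)\ge e^{-N\varepsilon_N^2C}$; and suppose there is $\epsilon>0$ with $d_H(P_\theta,P_0)>\epsilon$ for every $\theta\in\mathcal S$ whose model is not $M_1$. Then, with $\mathbf e_1$ the point mass on $M_1$: 1. For every $0<\delta<1$ and all sufficiently large $N$, $$P_0^N\big(Pr(M_1|X,Y)<1-\delta\big)\le\frac{1}{C^2N\varepsilon_N^2\delta}+\frac{2e^{-LN\varepsilon_N^2}}{\delta}+\frac{2e^{-2N\varepsilon_N^2}}{\delta}.$$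 2. For every $0<\delta<1$ and all sufficiently large $N$, $$P_0^N\big(d_E((Pr(M_k|X,Y))_k,\mathbf e_1)>\delta\big)\le\frac{\sqrt2}{C^2N\varepsilon_N^2\delta}+\frac{2\sqrt2\,e^{-LN\varepsilon_N^2}}{\delta}+\frac{2\sqrt2\,e^{-2N\varepsilon_N^2}}{\delta}.$$ 3. For every $0<\delta<\sqrt{(\sqrt2-1)^2+1}\,/2$ and all sufficiently large $N$, $$P_0^N\big(d_H((Pr(M_k|X,Y))_k,\mathbf e_1)>\delta\big)\le\frac{(\sqrt2-1)^2+1}{\sqrt2\,C^2N\varepsilon_N^2\delta^2}+\frac{((\sqrt2-1)^2+1)e^{-LN\varepsilon_N^2}}{\delta^2}+\frac{((\sqrt2-1)^2+1)e^{-2N\varepsilon_N^2}}{\delta^2}.$$ -/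

import Mathlib

open MeasureTheory Filter Topology
open scoped ENNReal

universe u v w

/-- A Bayesian model-selection problem for i.i.d. regression data `(X, Y) ∈ 𝒳 × 𝒴`, with
`K` candidate models.  The model with index `k` has parameter space `Θ k`, so that the domain
of `θ = (model index, parameters)` is `Σ k, Θ k`. -/
structure BayesModel (K : ℕ) (Θ : Fin K → Type u) [∀ k, MeasurableSpace (Θ k)]
    (𝒳 : Type v) [MeasurableSpace 𝒳] (𝒴 : Type w) [MeasurableSpace 𝒴] where
  /-- The true distribution `p₀(x)` of the covariates. -/
  covLaw : Measure 𝒳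
  isProbabilityMeasure_covLaw : IsProbabilityMeasure covLaw
  /-- The reference measure on the response space (e.g. Lebesgue measure). -/
  ref : Measure 𝒴
  sigmaFinite_ref : SigmaFinite ref
  /-- The conditional density `p(y | x, θ)`, with value `dens θ (x, y)`. -/
  dens : (Σ k, Θ k) → 𝒳 × 𝒴 → ℝ
  measurable_dens : Measurable (fun q : (Σ k, Θ k) × (𝒳 × 𝒴) => dens q.1 q.2)
  dens_nonneg : ∀ θ z, 0 ≤ dens θ z
  lintegral_dens : ∀ θ x, ∫⁻ y, ENNReal.ofReal (dens θ (x, y)) ∂ref = 1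
  /-- The prior on model index and parameters jointly. -/
  prior : Measure (Σ k, Θ k)
  isProbabilityMeasure_prior : IsProbabilityMeasure prior

/-- Hellinger distance between two measures having densities `f`, `g` with respect to a common
dominating measure `m`: the square root of `1/2 ∫ (√f - √g)² dm`. -/
noncomputable def hellingerDist {Ω : Type*} [MeasurableSpace Ω] (m : Measure Ω)
    (f g : Ω → ℝ) : ℝ :=
  √((1 / 2) * ∫ z, (√(f z) - √(g z)) ^ 2 ∂m)

/-- Hellinger distance between two probability vectors. -/
noncomputable def hellingerDistVec {ι : Type*} [Fintype ι] (p q : ι → ℝ) : ℝ :=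
  √((1 / 2) * ∑ i, (√(p i) - √(q i)) ^ 2)

/-- The `r`-packing number of `A` for the distance function `d`: the maximal number of points
of `A` any two of which are at distance at least `r`. -/
noncomputable def packingNumber {α : Type*} (d : α → α → ℝ) (r : ℝ) (A : Set α) : ℕ∞ :=
  ⨆ (B : Set α) (_ : B ⊆ A) (_ : B.Pairwise fun a b => r ≤ d a b), B.encard

namespace BayesModel

variable {K : ℕ} {Θ : Fin K → Type u} [∀ k, MeasurableSpace (Θ k)]
  {𝒳 : Type v} [MeasurableSpace 𝒳] {𝒴 : Type w} [MeasurableSpace 𝒴]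

/-- The measure `p₀(dx) × dy` that dominates every `P_θ`. -/
noncomputable def baseMeasure (M : BayesModel K Θ 𝒳 𝒴) : Measure (𝒳 × 𝒴) :=
  M.covLaw.prod M.ref

/-- The distribution `P_θ = p₀(x) × p(y | x, θ)` of one data point. -/
noncomputable def law (M : BayesModel K Θ 𝒳 𝒴) (θ : Σ k, Θ k) : Measure (𝒳 × 𝒴) :=
  M.baseMeasure.withDensity fun z => ENNReal.ofReal (M.dens θ z)

/-- The distribution `P_θ^N` of `N` independent data points. -/
noncomputable def dataLaw (M : BayesModel K Θ 𝒳 𝒴) (θ : Σ k, Θ k) (N : ℕ) :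
    Measure (Fin N → 𝒳 × 𝒴) :=
  Measure.pi fun _ => M.law θ

/-- The set `𝒫_S = {p₀(x) × p(y | x, θ) : θ ∈ S}`, each member being represented by its density
with respect to `M.baseMeasure`. -/
def densSet (M : BayesModel K Θ 𝒳 𝒴) (S : Set (Σ k, Θ k)) : Set (𝒳 × 𝒴 → ℝ) :=
  M.dens '' S

/-- The set of `θ` with `-P₀ log (p_θ / p₀) ≤ r²` and `P₀ (log (p_θ / p₀))² ≤ r²`.
The clause `0 < p_θ` (`P₀`-almost everywhere) expresses that the logarithm is `-∞` where `p_θ`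
vanishes; the bound on the (extended-valued) second moment makes the logarithm integrable. -/
def klNeighborhood (M : BayesModel K Θ 𝒳 𝒴) (θ₀ : Σ k, Θ k) (r : ℝ) : Set (Σ k, Θ k) :=
  {θ | (∀ᵐ z ∂M.law θ₀, 0 < M.dens θ z) ∧
    -(∫ z, Real.log (M.dens θ z / M.dens θ₀ z) ∂M.law θ₀) ≤ r ^ 2 ∧
    ∫⁻ z, ENNReal.ofReal (Real.log (M.dens θ z / M.dens θ₀ z) ^ 2) ∂M.law θ₀
      ≤ ENNReal.ofReal (r ^ 2)}

/-- The likelihood of `θ` for the data `z = ((X₁, Y₁), …, (X_N, Y_N))`. -/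
noncomputable def likelihood (M : BayesModel K Θ 𝒳 𝒴) {N : ℕ} (z : Fin N → 𝒳 × 𝒴)
    (θ : Σ k, Θ k) : ℝ≥0∞ :=
  ∏ i, ENNReal.ofReal (M.dens θ (z i))

/-- The posterior distribution `Pr(· | X, Y)` of `θ` given the data, by Bayes' formula. -/
noncomputable def posterior (M : BayesModel K Θ 𝒳 𝒴) {N : ℕ} (z : Fin N → 𝒳 × 𝒴) :
    Measure (Σ k, Θ k) :=
  (∫⁻ θ, M.likelihood z θ ∂M.prior)⁻¹ • M.prior.withDensity (M.likelihood z)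

/-- The posterior probability `Pr(M_k | X, Y)` of the model with index `k`. -/
noncomputable def modelProb (M : BayesModel K Θ 𝒳 𝒴) {N : ℕ} (z : Fin N → 𝒳 × 𝒴)
    (k : Fin K) : ℝ :=
  (M.posterior z).real {θ | θ.1 = k}

end BayesModel

/-!
The posterior probability of the wrong models is the quotient of the likelihood ratio
`∏ i, p_θ (z i) / p_θ₀ (z i)` integrated over the wrong models by the evidence, the same integral
over all `θ`.  Three estimates are combined by Markov's inequality
(`BayesModel.dataLaw_modelProb_lt_le_of_sieve`).

*Evidence.*  Averaging the log-likelihood ratio over the prior restricted to the Kullback–Leibler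
neighborhood and applying Jensen's and Chebyshev's inequalities shows that the evidence is rarely
small (`pi_lintegral_exp_sum_lt_le`).

*Wrong models outside the sieve.*  The expected integrated likelihood ratio of a set of parameters
is at most its prior mass.

*Wrong models in the sieve.*  They are covered by at most `exp (n * ε n ^ 2)` small Hellinger balls.
No tests are needed: the posterior probability of a ball is at most its own square root, and the
expected square root of an integrated likelihood ratio is the Hellinger affinity between the law of
the data and a mixture of product laws.  Since a mixture of densities close to `q` is again close to
`q`, the affinity of one observation with any mixture over the ball is at most `1 - η ^ 2 / 2`
(`affinity_mixture_le`), and by conditioning on the observations one at a time the affinity of `N`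
observations is at most the `N`-th power of that (`lintegral_rpow_pi_le`).

When `C` is large, the constant `1 / C ^ 2` does not come out of this argument if the hypotheses are
used at the sample size `N` only, because the deviation allowed in Chebyshev's inequality is limited by
the prior mass outside the sieve.  The neighborhood of the larger sample size `A * N` with
`C ^ 2 ≤ A` is used instead: with `b = max (N * ε N ^ 2) (A * N * ε (A * N) ^ 2)`, the log-likelihood
ratio of `N` observations has variance at most `N * ε (A * N) ^ 2 ≤ b / A`, so that a deviation by
`b` has probability at most `1 / (A * b)`.  The sieve is taken at the index at which the maximum is
attained.  As `ε` tends to `0`, `b` is negligible compared to `N`, so the wrong models in this sieve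
can still be excluded with `N` observations
(`BayesModel.eventually_dataLaw_modelProb_lt_le`).

The bounds for the two distances follow from the bound for the model probability, because the
model probabilities are nonnegative with sum at most `1`.
-/

/-! ### Hellinger affinity -/

/-- The Hellinger affinity `∫ √f √g dm` of two `ℝ≥0∞`-valued densities. -/
noncomputable def affinity {Ω : Type*} [MeasurableSpace Ω] (m : Measure Ω) (f g : Ω → ℝ≥0∞) :
    ℝ≥0∞ :=
  ∫⁻ z, f z ^ (1 / 2 : ℝ) * g z ^ (1 / 2 : ℝ) ∂m

theorem ENNReal.ofReal_rpow_half {x : ℝ} (hx : 0 ≤ x) :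
    ENNReal.ofReal x ^ (1 / 2 : ℝ) = ENNReal.ofReal (√x) := by
  rw [ENNReal.ofReal_rpow_of_nonneg hx (by norm_num), Real.sqrt_eq_rpow]

theorem ENNReal.rpow_half_mul_self (x : ℝ≥0∞) : x ^ (1 / 2 : ℝ) * x ^ (1 / 2 : ℝ) = x := by
  rw [← ENNReal.rpow_add_of_nonneg _ _ (by norm_num) (by norm_num)]
  norm_num

theorem hellingerDist_comm {Ω : Type*} [MeasurableSpace Ω] (m : Measure Ω) (f g : Ω → ℝ) :
    hellingerDist m f g = hellingerDist m g f := by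
  simp only [hellingerDist]
  congr 3
  ext z
  ring

/-- For probability densities, `d_H² = 1 - affinity`. -/
theorem affinity_eq_ofReal {Ω : Type*} [MeasurableSpace Ω] {m : Measure Ω} {f g : Ω → ℝ}
    (hf : Measurable f) (hg : Measurable g) (hf0 : ∀ z, 0 ≤ f z) (hg0 : ∀ z, 0 ≤ g z)
    (hf1 : ∫⁻ z, ENNReal.ofReal (f z) ∂m = 1) (hg1 : ∫⁻ z, ENNReal.ofReal (g z) ∂m = 1) :
    affinity m (fun z => ENNReal.ofReal (f z)) (fun z => ENNReal.ofReal (g z))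
      = ENNReal.ofReal (1 - hellingerDist m f g ^ 2) := by
  have hfi : Integrable f m := by
    refine ⟨hf.aestronglyMeasurable, ?_⟩
    rw [hasFiniteIntegral_iff_ofReal (Eventually.of_forall hf0), hf1]
    exact ENNReal.one_lt_top
  have hgi : Integrable g m := by
    refine ⟨hg.aestronglyMeasurable, ?_⟩
    rw [hasFiniteIntegral_iff_ofReal (Eventually.of_forall hg0), hg1]
    exact ENNReal.one_lt_top
  have hfv : ∫ z, f z ∂m = 1 := by
    rw [integral_eq_lintegral_of_nonneg_ae (Eventually.of_forall hf0) hf.aestronglyMeasurable, hf1]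
    simp
  have hgv : ∫ z, g z ∂m = 1 := by
    rw [integral_eq_lintegral_of_nonneg_ae (Eventually.of_forall hg0) hg.aestronglyMeasurable, hg1]
    simp
  have hsi : Integrable (fun z => √(f z) * √(g z)) m := by
    refine (hfi.add hgi).mono' (by fun_prop) (Eventually.of_forall fun z => ?_)
    rw [Real.norm_of_nonneg (by positivity)]
    simp only [Pi.add_apply]
    nlinarith [sq_nonneg (√(f z) - √(g z)), Real.sq_sqrt (hf0 z), Real.sq_sqrt (hg0 z), hf0 z,
      hg0 z]
  have hexp : ∫ z, (√(f z) - √(g z)) ^ 2 ∂m = 2 - 2 * ∫ z, √(f z) * √(g z) ∂m := by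
    have : ∀ z, (√(f z) - √(g z)) ^ 2 = (f z + g z) - 2 * (√(f z) * √(g z)) := fun z => by
      nlinarith [Real.sq_sqrt (hf0 z), Real.sq_sqrt (hg0 z)]
    simp_rw [this]
    rw [integral_sub (f := fun z => f z + g z) (hfi.add hgi) (hsi.const_mul 2),
      integral_add hfi hgi, hfv, hgv, integral_const_mul]
    norm_num
  have hsq : hellingerDist m f g ^ 2 = 1 - ∫ z, √(f z) * √(g z) ∂m := by
    have h0 : 0 ≤ ∫ z, (√(f z) - √(g z)) ^ 2 ∂m := integral_nonneg fun z => by positivity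
    rw [hellingerDist, Real.sq_sqrt (by positivity), hexp]
    ring
  rw [hsq, sub_sub_cancel, ofReal_integral_eq_lintegral_ofReal hsi
    (Eventually.of_forall fun z => by positivity)]
  refine lintegral_congr fun z => ?_
  simp only
  rw [ENNReal.ofReal_rpow_half (hf0 z), ENNReal.ofReal_rpow_half (hg0 z),
    ← ENNReal.ofReal_mul (Real.sqrt_nonneg _)]

/-- A form of `(u - v) w ≤ (l / 2) (u - v)² + w² / (2 l)` without subtraction. -/
theorem ENNReal.mul_add_mul_mul_le (x y z : ℝ≥0∞) {l : ℝ} (hl : 0 < l) :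
    x ^ (1 / 2 : ℝ) * z ^ (1 / 2 : ℝ)
        + ENNReal.ofReal l * (x ^ (1 / 2 : ℝ) * y ^ (1 / 2 : ℝ))
      ≤ y ^ (1 / 2 : ℝ) * z ^ (1 / 2 : ℝ) + ENNReal.ofReal (l / 2) * (x + y)
        + ENNReal.ofReal (1 / (2 * l)) * z := by
  have h1 : ENNReal.ofReal (l / 2) ≠ 0 := by simpa using hl
  have h2 : ENNReal.ofReal (1 / (2 * l)) ≠ 0 := by simpa using hl
  rcases eq_or_ne x ⊤ with rfl | hx
  · rw [top_add, ENNReal.mul_top h1]; simp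
  rcases eq_or_ne y ⊤ with rfl | hy
  · rw [add_top, ENNReal.mul_top h1]; simp
  rcases eq_or_ne z ⊤ with rfl | hz
  · rw [ENNReal.mul_top h2]; simp
  obtain ⟨x, hx0, rfl⟩ : ∃ r : ℝ, 0 ≤ r ∧ x = ENNReal.ofReal r :=
    ⟨x.toReal, ENNReal.toReal_nonneg, (ENNReal.ofReal_toReal hx).symm⟩
  obtain ⟨y, hy0, rfl⟩ : ∃ r : ℝ, 0 ≤ r ∧ y = ENNReal.ofReal r :=
    ⟨y.toReal, ENNReal.toReal_nonneg, (ENNReal.ofReal_toReal hy).symm⟩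
  obtain ⟨z, hz0, rfl⟩ : ∃ r : ℝ, 0 ≤ r ∧ z = ENNReal.ofReal r :=
    ⟨z.toReal, ENNReal.toReal_nonneg, (ENNReal.ofReal_toReal hz).symm⟩
  rw [ENNReal.ofReal_rpow_half hx0, ENNReal.ofReal_rpow_half hy0, ENNReal.ofReal_rpow_half hz0,
    ← ENNReal.ofReal_mul (by positivity), ← ENNReal.ofReal_mul (by positivity),
    ← ENNReal.ofReal_mul (by positivity), ← ENNReal.ofReal_add (by positivity) (by positivity),
    ← ENNReal.ofReal_mul (by positivity), ← ENNReal.ofReal_add (by positivity) (by positivity),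
    ← ENNReal.ofReal_mul (by positivity), ← ENNReal.ofReal_mul (by positivity),
    ← ENNReal.ofReal_add (by positivity) (by positivity),
    ← ENNReal.ofReal_add (by positivity) (by positivity)]
  refine ENNReal.ofReal_le_ofReal ?_
  have hx' := Real.sq_sqrt hx0
  have hy' := Real.sq_sqrt hy0
  have hz' := Real.sq_sqrt hz0
  set u := √x
  set v := √y
  set w := √z
  rw [← hx', ← hy', ← hz', ← sub_nonneg]
  have : v * w + l / 2 * (u ^ 2 + v ^ 2) + 1 / (2 * l) * w ^ 2 - (u * w + l * (u * v))
      = (l * (u - v) - w) ^ 2 / (2 * l) := by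
    field_simp
    ring
  rw [this]
  positivity

/-- Jensen's inequality for the square root. -/
theorem lintegral_rpow_half_le {Θ : Type*} [MeasurableSpace Θ] (π : Measure Θ)
    [IsProbabilityMeasure π] {f : Θ → ℝ≥0∞} (hf : Measurable f) :
    ∫⁻ θ, f θ ^ (1 / 2 : ℝ) ∂π ≤ (∫⁻ θ, f θ ∂π) ^ (1 / 2 : ℝ) := by
  have h := ENNReal.lintegral_mul_le_Lp_mul_Lq π Real.HolderConjugate.two_two
    (f := fun θ => f θ ^ (1 / 2 : ℝ)) (g := fun _ => 1) (by fun_prop) (by fun_prop)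
  simp only [← ENNReal.rpow_mul, mul_one, lintegral_one, measure_univ, ENNReal.one_rpow] at h
  norm_num at h ⊢
  exact h

/-- If almost all the components `p θ` of a mixture are close to `q`, and `q` is far from `g`, then
the mixture is far from `g`. -/
theorem affinity_mixture_le {Ω Θ : Type*} [MeasurableSpace Ω] [MeasurableSpace Θ]
    {m : Measure Ω} [SFinite m] {π : Measure Θ} [IsProbabilityMeasure π] {p : Θ → Ω → ℝ≥0∞}
    (hp : Measurable (Function.uncurry p)) {q g : Ω → ℝ≥0∞} (hq : Measurable q)
    (hg : Measurable g) (hp1 : ∀ᵐ θ ∂π, ∫⁻ z, p θ z ∂m = 1) (hq1 : ∫⁻ z, q z ∂m = 1)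
    (hg1 : ∫⁻ z, g z ∂m = 1) {a b l : ℝ} (ha : a ≤ 1) (hb : b ≤ 1) (hl : 0 < l)
    (hclose : ∀ᵐ θ ∂π, ENNReal.ofReal (1 - a) ≤ affinity m (p θ) q)
    (hfar : affinity m q g ≤ ENNReal.ofReal (1 - b)) :
    affinity m (fun z => ∫⁻ θ, p θ z ∂π) g ≤ ENNReal.ofReal (1 - b + l * a + 1 / (2 * l)) := by
  have hp' : ∀ z, Measurable fun θ => p θ z := fun z => hp.comp measurable_prodMk_right
  have hpm : Measurable fun z => ∫⁻ θ, p θ z ∂π :=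
    Measurable.lintegral_prod_left (f := p) hp
  have hmix1 : ∫⁻ z, ∫⁻ θ, p θ z ∂π ∂m = 1 := by
    rw [lintegral_lintegral_swap (f := fun z θ => p θ z) (hp.comp measurable_swap).aemeasurable,
      lintegral_congr_ae hp1]
    simp
  have hmixq : ENNReal.ofReal (1 - a) ≤ affinity m (fun z => ∫⁻ θ, p θ z ∂π) q := by
    calc ENNReal.ofReal (1 - a) = ∫⁻ _, ENNReal.ofReal (1 - a) ∂π := by simp
      _ ≤ ∫⁻ θ, ∫⁻ z, p θ z ^ (1 / 2 : ℝ) * q z ^ (1 / 2 : ℝ) ∂m ∂π := lintegral_mono_ae hclose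
      _ = ∫⁻ z, ∫⁻ θ, p θ z ^ (1 / 2 : ℝ) * q z ^ (1 / 2 : ℝ) ∂π ∂m :=
        lintegral_lintegral_swap
          ((hp.pow_const _).mul ((hq.comp measurable_snd).pow_const _)).aemeasurable
      _ ≤ affinity m (fun z => ∫⁻ θ, p θ z ∂π) q := by
        refine lintegral_mono fun z => ?_
        rw [lintegral_mul_const _ ((hp' z).pow_const _)]
        gcongr
        exact lintegral_rpow_half_le π (hp' z)
  have hint := lintegral_mono (μ := m) fun z =>
    ENNReal.mul_add_mul_mul_le (∫⁻ θ, p θ z ∂π) (q z) (g z) hl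
  rw [lintegral_add_left (by fun_prop), lintegral_const_mul _ (by fun_prop),
    lintegral_add_right _ (by fun_prop), lintegral_add_right _ (by fun_prop),
    lintegral_const_mul _ (by fun_prop), lintegral_const_mul _ (by fun_prop),
    lintegral_add_right _ (by fun_prop), hmix1, hq1, hg1] at hint
  change affinity m (fun z => ∫⁻ θ, p θ z ∂π) g
    + ENNReal.ofReal l * affinity m (fun z => ∫⁻ θ, p θ z ∂π) q ≤ affinity m q g + _ + _ at hint
  have hla : 0 ≤ l * (1 - a) := mul_nonneg hl.le (by linarith)
  rw [← ENNReal.add_le_add_iff_right (a := ENNReal.ofReal (l * (1 - a))) ENNReal.ofReal_ne_top]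
  calc _ ≤ affinity m (fun z => ∫⁻ θ, p θ z ∂π) g
        + ENNReal.ofReal l * affinity m (fun z => ∫⁻ θ, p θ z ∂π) q := by
        rw [ENNReal.ofReal_mul hl.le]
        gcongr
    _ ≤ _ := hint
    _ ≤ ENNReal.ofReal (1 - b) + ENNReal.ofReal (l / 2) * (1 + 1)
        + ENNReal.ofReal (1 / (2 * l)) * 1 := by gcongr
    _ = ENNReal.ofReal (1 - b + l + 1 / (2 * l)) := by
        have h2 : ENNReal.ofReal (l / 2) * (1 + 1) = ENNReal.ofReal l := by
          rw [mul_add, mul_one, ← ENNReal.ofReal_add (by positivity) (by positivity), add_halves]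
        rw [h2, mul_one, ← ENNReal.ofReal_add (by linarith) hl.le,
          ← ENNReal.ofReal_add (by linarith) (by positivity)]
    _ = ENNReal.ofReal ((1 - b + l * a + 1 / (2 * l)) + l * (1 - a)) := by congr 1; ring
    _ ≤ _ := ENNReal.ofReal_add_le

/-! ### Packing numbers -/

/-- A maximal `r`-separated subset of `X` is an `r`-net of `X`. -/
theorem exists_net_encard_le_packingNumber {α : Type*} {d : α → α → ℝ}
    (hd : ∀ a b, d a b = d b a) {r : ℝ} {X A : Set α} (hXA : X ⊆ A) :
    ∃ B ⊆ X, B.encard ≤ packingNumber d r A ∧ ∀ x ∈ X, x ∈ B ∨ ∃ b ∈ B, d x b < r := by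
  obtain ⟨B, hB⟩ := zorn_subset {B : Set α | B ⊆ X ∧ B.Pairwise fun a b => r ≤ d a b} <| by
    intro c hc hchain
    refine ⟨⋃₀ c, ⟨Set.sUnion_subset fun s hs => (hc hs).1, ?_⟩,
      fun s hs => Set.subset_sUnion_of_mem hs⟩
    exact (Set.pairwise_sUnion hchain.directedOn).2 fun s hs => (hc hs).2
  refine ⟨B, hB.prop.1, ?_, fun x hx => ?_⟩
  · exact le_iSup_of_le B (le_iSup_of_le (hB.prop.1.trans hXA) (le_iSup_of_le hB.prop.2 le_rfl))
  · by_contra! h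
    refine h.1 (hB.mem_of_prop_insert ⟨Set.insert_subset hx hB.prop.1, ?_⟩)
    refine Set.pairwise_insert.2 ⟨hB.prop.2, fun b hb _ => ⟨h.2 b hb, ?_⟩⟩
    rw [hd]
    exact h.2 b hb

/-! ### Distances of subprobability vectors from a point mass -/

theorem dist_single_le {ι : Type*} [Fintype ι] [DecidableEq ι] (p : ι → ℝ) (k : ι)
    (hp : ∀ i, 0 ≤ p i) (hs : ∑ i, p i ≤ 1) :
    dist (WithLp.toLp 2 p : EuclideanSpace ℝ ι) (EuclideanSpace.single k 1) ≤ √2 * (1 - p k) := by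
  have hsum : ∑ i ∈ Finset.univ.erase k, p i ≤ 1 - p k := by
    have := Finset.add_sum_erase Finset.univ p (Finset.mem_univ k)
    linarith
  have h0 : 0 ≤ ∑ i ∈ Finset.univ.erase k, p i := Finset.sum_nonneg fun i _ => hp i
  rw [EuclideanSpace.dist_eq, ← Finset.add_sum_erase _ _ (Finset.mem_univ k)]
  refine Real.sqrt_le_iff.2 ⟨mul_nonneg (by positivity) (by linarith), ?_⟩
  have h1 : ∑ i ∈ Finset.univ.erase k,
      dist (p i) ((EuclideanSpace.single k (1 : ℝ) : EuclideanSpace ℝ ι) i) ^ 2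
        ≤ (∑ i ∈ Finset.univ.erase k, p i) ^ 2 := by
    refine le_trans (le_of_eq (Finset.sum_congr rfl fun i hi => ?_))
      (Finset.sum_sq_le_sq_sum_of_nonneg fun i _ => hp i)
    simp [Finset.ne_of_mem_erase hi]
  have h2 : dist (p k) ((EuclideanSpace.single k (1 : ℝ) : EuclideanSpace ℝ ι) k) ^ 2
      = (1 - p k) ^ 2 := by
    rw [Real.dist_eq, sq_abs]
    simp
    ring
  have h3 : (√2 * (1 - p k)) ^ 2 = 2 * (1 - p k) ^ 2 := by
    rw [mul_pow, Real.sq_sqrt (by norm_num)]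
  simp only at h1 h2 ⊢
  nlinarith

theorem hellingerDistVec_single_sq_le {ι : Type*} [Fintype ι] [DecidableEq ι] (p : ι → ℝ) (k : ι)
    (hp : ∀ i, 0 ≤ p i) (hs : ∑ i, p i ≤ 1) :
    hellingerDistVec p (Pi.single k 1) ^ 2 ≤ 1 - √(p k) := by
  have hsum : ∑ i ∈ Finset.univ.erase k, p i ≤ 1 - p k := by
    have := Finset.add_sum_erase Finset.univ p (Finset.mem_univ k)
    linarith
  rw [hellingerDistVec, Real.sq_sqrt (by positivity),
    ← Finset.add_sum_erase _ _ (Finset.mem_univ k)]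
  have h1 : ∑ i ∈ Finset.univ.erase k, (√(p i) - √((Pi.single k 1 : ι → ℝ) i)) ^ 2
      = ∑ i ∈ Finset.univ.erase k, p i :=
    Finset.sum_congr rfl fun i hi => by
      simp [Finset.ne_of_mem_erase hi, Real.sq_sqrt (hp i)]
  rw [h1]
  simp only [Pi.single_eq_same, Real.sqrt_one]
  nlinarith [Real.sq_sqrt (hp k)]

/-! ### Affinity of mixtures of product densities -/

theorem measurable_prod_eval {Z Θ : Type*} [MeasurableSpace Z] [MeasurableSpace Θ]
    {R : Θ → Z → ℝ≥0∞} (hR : Measurable (Function.uncurry R)) (N : ℕ) :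
    Measurable fun q : (Fin N → Z) × Θ => ∏ i, R q.2 (q.1 i) :=
  Finset.measurable_prod _ fun i _ => hR.comp
    (measurable_snd.prodMk ((measurable_pi_apply i).comp measurable_fst))

/-- If `ρ` bounds the `s`-th moment of all mixtures of `R θ`, `θ ∈ A`, for one observation, then
`ρ ^ N` bounds that of all mixtures of the `N`-fold products (`s = 1 / 2` concerns the affinity,
`s = 1` the expectation).  The induction step conditions on the
first observation `z₀`, which replaces the mixing measure `ν` by `R · z₀ • ν`; this is why the bound
is required for all mixing measures at once. -/
theorem lintegral_rpow_pi_le {Z Θ : Type*} [MeasurableSpace Z] [MeasurableSpace Θ]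
    {μ : Measure Z} [IsProbabilityMeasure μ] {R : Θ → Z → ℝ≥0∞}
    (hR : Measurable (Function.uncurry R)) {A : Set Θ} {ρ : ℝ≥0∞} {s : ℝ}
    (h : ∀ ν : Measure Θ, SFinite ν → ν Aᶜ = 0 →
      ∫⁻ z, (∫⁻ θ, R θ z ∂ν) ^ s ∂μ ≤ ρ * ν Set.univ ^ s) (N : ℕ) :
    ∀ ν : Measure Θ, SFinite ν → ν Aᶜ = 0 →
      ∫⁻ z : Fin N → Z, (∫⁻ θ, ∏ i, R θ (z i) ∂ν) ^ s ∂Measure.pi (fun _ => μ)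
        ≤ ρ ^ N * ν Set.univ ^ s := by
  induction N with
  | zero =>
    intro ν _ _
    simp
  | succ N ih =>
    intro ν _ hν
    have hRz : ∀ z, Measurable fun θ => R θ z := fun z => hR.comp measurable_prodMk_right
    have hmeas : Measurable fun z : Fin (N + 1) → Z =>
        (∫⁻ θ, ∏ i, R θ (z i) ∂ν) ^ s :=
      (Measurable.lintegral_prod_right (measurable_prod_eval hR (N + 1))).pow_const _
    have hmp := (measurePreserving_piFinSuccAbove (fun _ : Fin (N + 1) => μ) 0).symm
    rw [← hmp.lintegral_comp hmeas,
      lintegral_prod _ (by exact (hmeas.comp (MeasurableEquiv.measurable _)).aemeasurable)]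
    calc _ ≤ ∫⁻ z₀, ρ ^ N * (∫⁻ θ, R θ z₀ ∂ν) ^ s ∂μ := by
          refine lintegral_mono fun z₀ => ?_
          have hac : ν.withDensity (fun θ => R θ z₀) Aᶜ = 0 :=
            withDensity_absolutelyContinuous ν _ hν
          have := ih (ν.withDensity fun θ => R θ z₀) inferInstance hac
          rw [withDensity_apply _ MeasurableSet.univ, setLIntegral_univ] at this
          refine le_trans (le_of_eq (lintegral_congr fun z => ?_)) this
          rw [lintegral_withDensity_eq_lintegral_mul _ (hRz z₀)
            (Finset.measurable_prod _ fun i _ => hRz (z i))]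
          simp [MeasurableEquiv.piFinSuccAbove, Fin.prod_univ_succ]
      _ = ρ ^ N * ∫⁻ z₀, (∫⁻ θ, R θ z₀ ∂ν) ^ s ∂μ :=
          lintegral_const_mul _
            ((Measurable.lintegral_prod_left (f := R) hR).pow_const _)
      _ ≤ ρ ^ N * (ρ * ν Set.univ ^ s) := by
          gcongr
          exact h ν inferInstance hν
      _ = ρ ^ (N + 1) * ν Set.univ ^ s := by rw [pow_succ, mul_assoc]

/-! ### Lower bound for the evidence -/

/-- Jensen's inequality for the exponential function. -/
theorem ofReal_exp_integral_le {Θ : Type*} [MeasurableSpace Θ] {π : Measure Θ}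
    [IsProbabilityMeasure π] {g : Θ → ℝ} (hg : Integrable g π) :
    ENNReal.ofReal (Real.exp (∫ θ, g θ ∂π)) ≤ ∫⁻ θ, ENNReal.ofReal (Real.exp (g θ)) ∂π := by
  set c := ∫ θ, g θ ∂π with hc
  by_cases htop : ∫⁻ θ, ENNReal.ofReal (Real.exp (g θ)) ∂π = ⊤
  · rw [htop]; exact le_top
  have hexp : Integrable (fun θ => Real.exp (g θ)) π := by
    refine ⟨Real.measurable_exp.comp_aemeasurable hg.aemeasurable |>.aestronglyMeasurable, ?_⟩
    rw [hasFiniteIntegral_iff_ofReal (Eventually.of_forall fun θ => (Real.exp_pos _).le)]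
    exact lt_top_iff_ne_top.2 htop
  rw [← ofReal_integral_eq_lintegral_ofReal hexp
    (Eventually.of_forall fun θ => (Real.exp_pos _).le)]
  refine ENNReal.ofReal_le_ofReal ?_
  have htan : ∀ θ, Real.exp c * (1 - c + g θ) ≤ Real.exp (g θ) := fun θ => by
    have h1 := Real.add_one_le_exp (g θ - c)
    calc Real.exp c * (1 - c + g θ) ≤ Real.exp c * Real.exp (g θ - c) := by
          gcongr; linarith
      _ = Real.exp (g θ) := by rw [← Real.exp_add]; congr 1; ring
  have hlin : ∫ θ, Real.exp c * (1 - c + g θ) ∂π = Real.exp c := by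
    rw [integral_const_mul, integral_add (integrable_const _) hg, ← hc]
    simp
  rw [← hlin]
  exact integral_mono (((integrable_const _).add hg).const_mul _) hexp htan

/-- A random log-likelihood ratio `g θ`, averaged over a prior `π`, has mean at least `-v` and
variance at most `v` as soon as each `g θ` has mean at least `-v` and second moment at most `v`;
by Chebyshev's inequality the sum over a sample of size `N` is rarely below `-(N v + t)`, and
Jensen's inequality transfers this to the integrated likelihood ratio. -/
theorem pi_lintegral_exp_sum_lt_le {Z Θ : Type*} [MeasurableSpace Z] [MeasurableSpace Θ]
    {μ : Measure Z} [IsProbabilityMeasure μ] {π : Measure Θ} [IsProbabilityMeasure π]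
    {g : Θ → Z → ℝ} (hg : Measurable (Function.uncurry g)) {v t : ℝ} (hv : 0 ≤ v) (ht : 0 < t)
    (hmean : ∀ᵐ θ ∂π, -(∫ z, g θ z ∂μ) ≤ v)
    (hsq : ∀ᵐ θ ∂π, ∫⁻ z, ENNReal.ofReal (g θ z ^ 2) ∂μ ≤ ENNReal.ofReal v) (N : ℕ) :
    Measure.pi (fun _ : Fin N => μ)
        {z | ∫⁻ θ, ENNReal.ofReal (Real.exp (∑ i, g θ (z i))) ∂π
          < ENNReal.ofReal (Real.exp (-(N * v + t)))}
      ≤ ENNReal.ofReal (N * v / t ^ 2) := by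
  have hgm : Measurable fun q : Θ × Z => g q.1 q.2 := hg
  have hsqtot : ∫⁻ q, ENNReal.ofReal (g q.1 q.2 ^ 2) ∂(π.prod μ) ≤ ENNReal.ofReal v := by
    rw [lintegral_prod _ (by fun_prop)]
    calc _ ≤ ∫⁻ _, ENNReal.ofReal v ∂π := lintegral_mono_ae hsq
      _ = _ := by simp
  have hsqi : Integrable (fun q : Θ × Z => g q.1 q.2 ^ 2) (π.prod μ) := by
    refine ⟨by fun_prop, ?_⟩
    rw [hasFiniteIntegral_iff_ofReal (Eventually.of_forall fun q => sq_nonneg _)]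
    exact hsqtot.trans_lt ENNReal.ofReal_lt_top
  have hLp : MemLp (fun q : Θ × Z => g q.1 q.2) 2 (π.prod μ) :=
    (memLp_two_iff_integrable_sq (by fun_prop)).2 hsqi
  have hgi : Integrable (fun q : Θ × Z => g q.1 q.2) (π.prod μ) := hLp.integrable (by norm_num)
  have hsqv : ∫ q, g q.1 q.2 ^ 2 ∂(π.prod μ) ≤ v := by
    rw [integral_eq_lintegral_of_nonneg_ae (Eventually.of_forall fun q => sq_nonneg _)
      (by fun_prop)]
    exact ENNReal.toReal_le_of_le_ofReal hv hsqtot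
  set Y : Z → ℝ := fun z => ∫ θ, g θ z ∂π with hY
  have hYm : StronglyMeasurable Y :=
    StronglyMeasurable.integral_prod_left (f := g) hgm.stronglyMeasurable
  have hsec : ∀ᵐ z ∂μ, Integrable (fun θ => g θ z) π := hgi.prod_left_ae
  have hsec2 : ∀ᵐ z ∂μ, Integrable (fun θ => g θ z ^ 2) π := hsqi.prod_left_ae
  have hYsq : ∀ᵐ z ∂μ, Y z ^ 2 ≤ ∫ θ, g θ z ^ 2 ∂π := by
    filter_upwards [hsec, hsec2] with z h1 h2
    have h0 : 0 ≤ ∫ θ, (g θ z ^ 2 - 2 * Y z * g θ z + Y z ^ 2) ∂π :=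
      integral_nonneg fun θ => by
        simp only [Pi.zero_apply]
        nlinarith [sq_nonneg (g θ z - Y z)]
    rw [integral_add (f := fun θ => g θ z ^ 2 - 2 * Y z * g θ z) (h2.sub (h1.const_mul _))
      (integrable_const _), integral_sub h2 (h1.const_mul _), integral_const_mul] at h0
    simp only [integral_const, probReal_univ, one_smul] at h0
    change 0 ≤ _ - 2 * Y z * Y z + Y z ^ 2 at h0
    nlinarith
  have hYsqi : Integrable (fun z => Y z ^ 2) μ :=
    hsqi.integral_prod_right.mono' (hYm.measurable.pow_const 2).aestronglyMeasurable <| by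
      filter_upwards [hYsq] with z hz
      rwa [Real.norm_of_nonneg (sq_nonneg _)]
  have hYLp : MemLp Y 2 μ := (memLp_two_iff_integrable_sq hYm.aestronglyMeasurable).2 hYsqi
  have hYvar : ProbabilityTheory.variance Y μ ≤ v := by
    refine (ProbabilityTheory.variance_le_expectation_sq hYm.aestronglyMeasurable).trans ?_
    calc ∫ z, (Y ^ 2) z ∂μ ≤ ∫ z, ∫ θ, g θ z ^ 2 ∂π ∂μ :=
          integral_mono_ae (f := fun z => (Y ^ 2) z) hYsqi hsqi.integral_prod_right (by exact hYsq)
      _ = ∫ q, g q.1 q.2 ^ 2 ∂(π.prod μ) := (integral_prod_symm _ hsqi).symm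
      _ ≤ v := hsqv
  have hYmean : -v ≤ ∫ z, Y z ∂μ := by
    have h1 : ∫ z, Y z ∂μ = ∫ θ, ∫ z, g θ z ∂μ ∂π := by
      rw [← integral_prod _ hgi, integral_prod_symm _ hgi]
    rw [h1]
    calc -v = ∫ _, -v ∂π := by simp
      _ ≤ _ := integral_mono_ae (integrable_const _) hgi.integral_prod_left (by
        filter_upwards [hmean] with θ hθ
        linarith)
  set X : (Fin N → Z) → ℝ := ∑ i, fun z : Fin N → Z => Y (z i) with hX
  have heval : ∀ i : Fin N, MemLp (fun z : Fin N → Z => Y (z i)) 2 (Measure.pi fun _ => μ) :=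
    fun i => hYLp.comp_measurePreserving (measurePreserving_eval (fun _ => μ) i)
  have hXLp : MemLp X 2 (Measure.pi fun _ => μ) := memLp_finsetSum' _ fun i _ => heval i
  have hXvar : ProbabilityTheory.variance X (Measure.pi fun _ => μ) ≤ N * v := by
    rw [hX, ProbabilityTheory.variance_sum_pi (X := fun _ => Y) fun _ => hYLp]
    simp only [Finset.sum_const, Finset.card_univ, Fintype.card_fin, nsmul_eq_mul]
    gcongr
  have hXmean : -(N * v) ≤ ∫ z, X z ∂(Measure.pi fun _ => μ) := by
    simp only [hX, Finset.sum_apply]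
    rw [integral_finsetSum _ fun i _ => (heval i).integrable (by norm_num)]
    simp_rw [integral_comp_eval (μ := fun _ : Fin N => μ) (f := Y) hYm.aestronglyMeasurable]
    simp only [Finset.sum_const, Finset.card_univ, Fintype.card_fin, nsmul_eq_mul]
    nlinarith [(Nat.cast_nonneg N : (0 : ℝ) ≤ N)]
  have hsecN : ∀ᵐ z ∂(Measure.pi fun _ : Fin N => μ), ∀ i, Integrable (fun θ => g θ (z i)) π :=
    ae_all_iff.2 fun i =>
      (measurePreserving_eval (fun _ => μ) i).quasiMeasurePreserving.ae hsec
  refine (measure_mono_ae ?_).trans ((ProbabilityTheory.meas_ge_le_variance_div_sq hXLp ht).trans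
    (ENNReal.ofReal_le_ofReal (by gcongr)))
  filter_upwards [hsecN] with z hz hlt
  have hsum : ∫ θ, ∑ i, g θ (z i) ∂π = X z := by
    rw [integral_finsetSum _ fun i _ => hz i]
    simp [hX, hY]
  have hlt' := (ofReal_exp_integral_le (integrable_finsetSum Finset.univ fun i _ => hz i)).trans_lt
    hlt
  rw [hsum, ENNReal.ofReal_lt_ofReal_iff (Real.exp_pos _), Real.exp_lt_exp] at hlt'
  change t ≤ |X z - _|
  rw [abs_sub_comm]
  exact le_trans (by linarith) (le_abs_self _)

/-! ### Likelihood ratios and the posterior -/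

theorem measurableSet_sigma_fst {ι : Type*} {Θ : ι → Type*} [∀ k, MeasurableSpace (Θ k)]
    (s : Set ι) : MeasurableSet {θ : Σ k, Θ k | θ.1 ∈ s} := by
  refine MeasurableSpace.measurableSet_iInf.2 fun k => ?_
  change MeasurableSet (Sigma.mk k ⁻¹' {θ : Σ k, Θ k | θ.1 ∈ s})
  simp

namespace BayesModel

variable {K : ℕ} {Θ : Fin K → Type u} [∀ k, MeasurableSpace (Θ k)]
  {𝒳 : Type v} [MeasurableSpace 𝒳] {𝒴 : Type w} [MeasurableSpace 𝒴]
  (M : BayesModel K Θ 𝒳 𝒴) (θ₀ : Σ k, Θ k)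

instance : IsProbabilityMeasure M.covLaw := M.isProbabilityMeasure_covLaw

instance : SigmaFinite M.ref := M.sigmaFinite_ref

instance : IsProbabilityMeasure M.prior := M.isProbabilityMeasure_prior

instance : SigmaFinite M.baseMeasure := by unfold baseMeasure; infer_instance

theorem measurable_dens_apply (θ : Σ k, Θ k) : Measurable (M.dens θ) :=
  M.measurable_dens.comp measurable_prodMk_left

theorem lintegral_ofReal_dens (θ : Σ k, Θ k) :
    ∫⁻ z, ENNReal.ofReal (M.dens θ z) ∂M.baseMeasure = 1 := by
  have h := M.measurable_dens_apply θ
  rw [baseMeasure, lintegral_prod _ (by fun_prop)]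
  simp [M.lintegral_dens]

instance (θ : Σ k, Θ k) : IsProbabilityMeasure (M.law θ) := by
  refine ⟨?_⟩
  rw [law, withDensity_apply _ MeasurableSet.univ, setLIntegral_univ, M.lintegral_ofReal_dens]

instance (θ : Σ k, Θ k) (N : ℕ) : IsProbabilityMeasure (M.dataLaw θ N) := by
  unfold dataLaw; infer_instance

theorem ae_dens_pos (θ : Σ k, Θ k) : ∀ᵐ z ∂M.law θ, 0 < M.dens θ z := by
  have h := M.measurable_dens_apply θ
  rw [law, ae_withDensity_iff (by fun_prop)]
  exact Eventually.of_forall fun z hz => by simpa using hz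

theorem ae_dataLaw_of_ae_law {θ : Σ k, Θ k} {p : 𝒳 × 𝒴 → Prop} (h : ∀ᵐ z ∂M.law θ, p z) (N : ℕ) :
    ∀ᵐ z ∂M.dataLaw θ N, ∀ i, p (z i) :=
  ae_all_iff.2 fun i =>
    (measurePreserving_eval (fun _ => M.law θ) i).quasiMeasurePreserving.ae h

/-- The likelihood ratio `p_θ / p_θ₀` of one data point. -/
noncomputable def likRatio (θ : Σ k, Θ k) (z : 𝒳 × 𝒴) : ℝ≥0∞ :=
  ENNReal.ofReal (M.dens θ z / M.dens θ₀ z)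

theorem measurable_likRatio : Measurable (Function.uncurry (M.likRatio θ₀)) :=
  (M.measurable_dens.div
    ((M.measurable_dens_apply θ₀).comp measurable_snd)).ennreal_ofReal

/-- The likelihood ratio of the whole sample, integrated over the set `E` of parameters with respect
to the prior.  Its value at `E = univ` is the evidence, relative to the true density. -/
noncomputable def intRatio (E : Set (Σ k, Θ k)) {N : ℕ} (z : Fin N → 𝒳 × 𝒴) : ℝ≥0∞ :=
  ∫⁻ θ in E, ∏ i, M.likRatio θ₀ θ (z i) ∂M.prior

theorem measurable_intRatio (E : Set (Σ k, Θ k)) (N : ℕ) :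
    Measurable fun z : Fin N → 𝒳 × 𝒴 => M.intRatio θ₀ E z :=
  Measurable.lintegral_prod_right (measurable_prod_eval (M.measurable_likRatio θ₀) N)

theorem intRatio_mono {E F : Set (Σ k, Θ k)} (h : E ⊆ F) {N : ℕ} (z : Fin N → 𝒳 × 𝒴) :
    M.intRatio θ₀ E z ≤ M.intRatio θ₀ F z :=
  lintegral_mono_set h

theorem lintegral_likRatio_le (θ : Σ k, Θ k) : ∫⁻ z, M.likRatio θ₀ θ z ∂M.law θ₀ ≤ 1 := by
  have h := M.measurable_dens_apply θ
  have h₀ := M.measurable_dens_apply θ₀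
  rw [law, lintegral_withDensity_eq_lintegral_mul _ (by fun_prop)
    (by unfold likRatio; fun_prop), ← M.lintegral_ofReal_dens θ]
  refine lintegral_mono fun z => ?_
  simp only [Pi.mul_apply, likRatio]
  rw [← ENNReal.ofReal_mul (M.dens_nonneg _ _)]
  refine ENNReal.ofReal_le_ofReal ?_
  rcases (M.dens_nonneg θ₀ z).eq_or_lt with h0 | h0
  · rw [← h0, zero_mul]; exact M.dens_nonneg _ _
  · rw [mul_div_cancel₀ _ h0.ne']

theorem lintegral_intRatio_le {E : Set (Σ k, Θ k)} (N : ℕ) :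
    ∫⁻ z, M.intRatio θ₀ E z ∂M.dataLaw θ₀ N ≤ M.prior E := by
  have := lintegral_rpow_pi_le (μ := M.law θ₀) (s := 1) (ρ := 1) (A := Set.univ)
    (M.measurable_likRatio θ₀) (fun ν _ _ => ?_) N (M.prior.restrict E) inferInstance (by simp)
  · simp only [ENNReal.rpow_one, one_pow, one_mul, Measure.restrict_apply_univ] at this
    exact this
  · simp only [ENNReal.rpow_one, one_mul]
    rw [lintegral_lintegral_swap (f := fun z θ => M.likRatio θ₀ θ z)
      ((M.measurable_likRatio θ₀).comp measurable_swap).aemeasurable]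
    calc _ ≤ ∫⁻ _, 1 ∂ν := lintegral_mono fun θ => M.lintegral_likRatio_le θ₀ θ
      _ = _ := by simp

theorem posterior_apply_eq {N : ℕ} {z : Fin N → 𝒳 × 𝒴} (hz : ∀ i, 0 < M.dens θ₀ (z i))
    {E : Set (Σ k, Θ k)} (hE : MeasurableSet E) :
    M.posterior z E = M.intRatio θ₀ E z / M.intRatio θ₀ Set.univ z := by
  set k := M.likelihood z θ₀ with hk
  have hk0 : k ≠ 0 := Finset.prod_ne_zero_iff.2 fun i _ => by simpa using hz i
  have hkt : k ≠ ⊤ := ENNReal.prod_ne_top fun i _ => ENNReal.ofReal_ne_top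
  have hlik : ∀ θ, M.likelihood z θ = k * ∏ i, M.likRatio θ₀ θ (z i) := fun θ => by
    rw [hk, likelihood, likelihood, ← Finset.prod_mul_distrib]
    refine Finset.prod_congr rfl fun i _ => ?_
    rw [likRatio, ← ENNReal.ofReal_mul (hz i).le, mul_div_cancel₀ _ (hz i).ne']
  have hmeas : Measurable fun θ => ∏ i, M.likRatio θ₀ θ (z i) :=
    (measurable_prod_eval (M.measurable_likRatio θ₀) N).comp measurable_prodMk_left
  have hint : ∀ F, ∫⁻ θ in F, M.likelihood z θ ∂M.prior = k * M.intRatio θ₀ F z := fun F => by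
    simp_rw [hlik]
    exact lintegral_const_mul _ hmeas
  have huniv := hint Set.univ
  rw [setLIntegral_univ] at huniv
  rw [posterior, Measure.smul_apply, withDensity_apply _ hE, hint, huniv, smul_eq_mul, mul_comm,
    ← div_eq_mul_inv, ENNReal.mul_div_mul_left _ _ hk0 hkt]

theorem posterior_univ_le {N : ℕ} (z : Fin N → 𝒳 × 𝒴) : M.posterior z Set.univ ≤ 1 := by
  rw [posterior, Measure.smul_apply, withDensity_apply _ MeasurableSet.univ, setLIntegral_univ,
    smul_eq_mul]
  exact ENNReal.inv_mul_le_one _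

theorem modelProb_nonneg {N : ℕ} (z : Fin N → 𝒳 × 𝒴) (k : Fin K) : 0 ≤ M.modelProb z k :=
  measureReal_nonneg

/-- The sum is `1` unless the evidence is `0` or `∞`, in which case it is `0`. -/
theorem sum_modelProb_le {N : ℕ} (z : Fin N → 𝒳 × 𝒴) : ∑ k, M.modelProb z k ≤ 1 := by
  have : IsFiniteMeasure (M.posterior z) :=
    ⟨(M.posterior_univ_le z).trans_lt ENNReal.one_lt_top⟩
  have h := sum_measureReal_preimage_singleton (μ := M.posterior z) Finset.univ
    (f := fun θ : Σ k, Θ k => θ.1) fun k _ => measurableSet_sigma_fst {k}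
  have h1 : ∑ k, M.modelProb z k
      = (M.posterior z).real ((fun θ : Σ k, Θ k => θ.1) ⁻¹' ↑(Finset.univ : Finset (Fin K))) := h
  rw [h1]
  exact ENNReal.toReal_le_of_le_ofReal zero_le_one
    ((measure_mono (Set.subset_univ _)).trans (by simpa using M.posterior_univ_le z))

theorem le_posterior_of_modelProb_lt {N : ℕ} {z : Fin N → 𝒳 × 𝒴}
    (hz : ∀ i, 0 < M.dens θ₀ (z i)) (h0 : M.intRatio θ₀ Set.univ z ≠ 0)
    (ht : M.intRatio θ₀ Set.univ z ≠ ⊤) {k : Fin K} {δ : ℝ} (hδ : M.modelProb z k < 1 - δ) :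
    ENNReal.ofReal δ ≤ M.intRatio θ₀ {θ | θ.1 ≠ k} z / M.intRatio θ₀ Set.univ z := by
  have hprob : IsProbabilityMeasure (M.posterior z) :=
    ⟨by rw [M.posterior_apply_eq θ₀ hz MeasurableSet.univ, ENNReal.div_self h0 ht]⟩
  have hm : MeasurableSet {θ : Σ k, Θ k | θ.1 = k} := measurableSet_sigma_fst {k}
  have hcompl : {θ : Σ k, Θ k | θ.1 ≠ k} = {θ | θ.1 = k}ᶜ := rfl
  rw [hcompl, ← M.posterior_apply_eq θ₀ hz hm.compl, ← ofReal_measureReal,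
    probReal_compl_eq_one_sub hm]
  refine ENNReal.ofReal_le_ofReal ?_
  change δ ≤ 1 - M.modelProb z k
  linarith

/-- Markov's inequality for the posterior probability of the wrong models, which are covered by a
set `T` of small prior mass and finitely many cells `A b`.  The posterior probability of a cell is
at most `1`, hence at most its own square root; so it suffices to control the expectation of
the square root of the integrated likelihood ratio. -/
theorem dataLaw_modelProb_lt_le {N : ℕ} {k : Fin K} {δ : ℝ} (hδ : 0 < δ) {c : ℝ≥0∞}
    (hc : c ≠ 0) {ι : Type*} (B : Finset ι) (T : Set (Σ k, Θ k)) (A : ι → Set (Σ k, Θ k))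
    (hcover : {θ : Σ k, Θ k | θ.1 ≠ k} ⊆ T ∪ ⋃ b ∈ B, A b) :
    M.dataLaw θ₀ N {z | M.modelProb z k < 1 - δ}
      ≤ M.dataLaw θ₀ N {z | M.intRatio θ₀ Set.univ z < c}
        + (M.prior T / c + ∑ b ∈ B,
          (∫⁻ z, M.intRatio θ₀ (A b) z ^ (1 / 2 : ℝ) ∂M.dataLaw θ₀ N) / c ^ (1 / 2 : ℝ))
          / ENNReal.ofReal δ := by
  have hm := fun E => M.measurable_intRatio θ₀ E N
  set H : (Fin N → 𝒳 × 𝒴) → ℝ≥0∞ := fun z => M.intRatio θ₀ T z / c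
    + ∑ b ∈ B, M.intRatio θ₀ (A b) z ^ (1 / 2 : ℝ) / c ^ (1 / 2 : ℝ) with hH
  have hfin : ∀ᵐ z ∂M.dataLaw θ₀ N, M.intRatio θ₀ Set.univ z < ⊤ :=
    ae_lt_top (hm _) (((M.lintegral_intRatio_le θ₀ N).trans_lt
      (measure_lt_top _ _)).ne)
  have hpos := M.ae_dataLaw_of_ae_law (M.ae_dens_pos θ₀) N
  have hsub : M.dataLaw θ₀ N {z | M.modelProb z k < 1 - δ}
      ≤ M.dataLaw θ₀ N ({z | M.intRatio θ₀ Set.univ z < c} ∪ {z | ENNReal.ofReal δ ≤ H z}) := by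
    refine measure_mono_ae ?_
    filter_upwards [hfin, hpos] with z hzt hz hlt
    by_cases hzc : M.intRatio θ₀ Set.univ z < c
    · exact Or.inl hzc
    refine Or.inr ?_
    have hcD := not_lt.1 hzc
    have hD0 : M.intRatio θ₀ Set.univ z ≠ 0 := (lt_of_lt_of_le hc.bot_lt hcD).ne'
    refine (M.le_posterior_of_modelProb_lt θ₀ hz hD0 hzt.ne hlt).trans ?_
    have hW : M.intRatio θ₀ {θ | θ.1 ≠ k} z
        ≤ M.intRatio θ₀ T z + ∑ b ∈ B, M.intRatio θ₀ (A b) z := by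
      refine (M.intRatio_mono θ₀ hcover z).trans ((lintegral_union_le _ _ _).trans ?_)
      refine add_le_add le_rfl ?_
      simp only [intRatio, ← withDensity_apply' (μ := M.prior)]
      exact measure_biUnion_finset_le (μ := M.prior.withDensity _) B A
    refine (ENNReal.div_le_div_right hW _).trans ?_
    rw [ENNReal.add_div, div_eq_mul_inv (∑ b ∈ B, _), Finset.sum_mul]
    simp only [hH, ← div_eq_mul_inv]
    refine add_le_add (by gcongr) (Finset.sum_le_sum fun b _ => ?_)
    calc M.intRatio θ₀ (A b) z / M.intRatio θ₀ Set.univ z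
        = (M.intRatio θ₀ (A b) z / M.intRatio θ₀ Set.univ z) ^ (1 : ℝ) := (ENNReal.rpow_one _).symm
      _ ≤ (M.intRatio θ₀ (A b) z / M.intRatio θ₀ Set.univ z) ^ (1 / 2 : ℝ) :=
          ENNReal.rpow_le_rpow_of_exponent_ge
            (ENNReal.div_le_of_le_mul (by
              rw [one_mul]; exact M.intRatio_mono θ₀ (Set.subset_univ _) z)) (by norm_num)
      _ ≤ (M.intRatio θ₀ (A b) z / c) ^ (1 / 2 : ℝ) := by gcongr
      _ = _ := ENNReal.div_rpow_of_nonneg _ _ (by norm_num)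
  refine hsub.trans ((measure_union_le _ _).trans ?_)
  gcongr
  refine (meas_ge_le_lintegral_div (by fun_prop) (by simpa using hδ) ENNReal.ofReal_ne_top).trans ?_
  gcongr
  simp only [hH, div_eq_mul_inv]
  rw [lintegral_add_left (by fun_prop), lintegral_finsetSum _ (by fun_prop),
    lintegral_mul_const _ (hm _)]
  gcongr with b
  · exact M.lintegral_intRatio_le θ₀ N
  · rw [lintegral_mul_const _ (by fun_prop)]

/-! ### Wrong models in a small Hellinger ball -/

theorem affinity_dens_eq (θ θ' : Σ k, Θ k) :
    affinity M.baseMeasure (fun z => ENNReal.ofReal (M.dens θ z))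
        (fun z => ENNReal.ofReal (M.dens θ' z))
      = ENNReal.ofReal (1 - hellingerDist M.baseMeasure (M.dens θ) (M.dens θ') ^ 2) :=
  affinity_eq_ofReal (M.measurable_dens_apply θ) (M.measurable_dens_apply θ') (M.dens_nonneg θ)
    (M.dens_nonneg θ') (M.lintegral_ofReal_dens θ) (M.lintegral_ofReal_dens θ')

theorem lintegral_rpow_half_lintegral_likRatio_le (ν : Measure (Σ k, Θ k)) [SFinite ν] :
    ∫⁻ z, (∫⁻ θ, M.likRatio θ₀ θ z ∂ν) ^ (1 / 2 : ℝ) ∂M.law θ₀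
      ≤ affinity M.baseMeasure (fun z => ∫⁻ θ, ENNReal.ofReal (M.dens θ z) ∂ν)
        (fun z => ENNReal.ofReal (M.dens θ₀ z)) := by
  have h₀ := M.measurable_dens_apply θ₀
  have hR : ∀ z, Measurable fun θ => M.likRatio θ₀ θ z := fun z =>
    (M.measurable_likRatio θ₀).comp measurable_prodMk_right
  have hmeas : Measurable fun z => (∫⁻ θ, M.likRatio θ₀ θ z ∂ν) ^ (1 / 2 : ℝ) :=
    (Measurable.lintegral_prod_left (f := M.likRatio θ₀) (M.measurable_likRatio θ₀)).pow_const _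
  rw [law, lintegral_withDensity_eq_lintegral_mul _ (by fun_prop) hmeas]
  refine lintegral_mono fun z => ?_
  set y := ENNReal.ofReal (M.dens θ₀ z) with hy
  set x := ∫⁻ θ, M.likRatio θ₀ θ z ∂ν with hx
  have hxy : y * x ≤ ∫⁻ θ, ENNReal.ofReal (M.dens θ z) ∂ν := by
    rw [hx, ← lintegral_const_mul _ (hR z)]
    refine lintegral_mono fun θ => ?_
    simp only [hy, likRatio]
    rw [← ENNReal.ofReal_mul (M.dens_nonneg _ _)]
    refine ENNReal.ofReal_le_ofReal ?_
    rcases (M.dens_nonneg θ₀ z).eq_or_lt with h0 | h0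
    · rw [← h0, zero_mul]; exact M.dens_nonneg _ _
    · rw [mul_div_cancel₀ _ h0.ne']
  calc y * x ^ (1 / 2 : ℝ) = (y ^ (1 / 2 : ℝ) * y ^ (1 / 2 : ℝ)) * x ^ (1 / 2 : ℝ) := by
        rw [ENNReal.rpow_half_mul_self]
    _ = (y * x) ^ (1 / 2 : ℝ) * y ^ (1 / 2 : ℝ) := by
        rw [ENNReal.mul_rpow_of_nonneg _ _ (by norm_num)]; ring
    _ ≤ _ := by gcongr

/-- If the cell `A` lies in a Hellinger ball whose center `θ₁` is farther than `η` from the truth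
and whose radius is small compared to `η ^ 2`, then the integrated likelihood ratio of `A` has an
exponentially small square root. -/
theorem lintegral_intRatio_rpow_half_le {A : Set (Σ k, Θ k)} (hA : MeasurableSet A) {η r : ℝ}
    (hη : 0 < η) (hη1 : η < 1) (hr : r ^ 2 ≤ η ^ 4 / 8) {θ₁ : Σ k, Θ k}
    (hclose : ∀ θ ∈ A, ENNReal.ofReal (1 - r ^ 2) ≤
      affinity M.baseMeasure (fun z => ENNReal.ofReal (M.dens θ z))
        (fun z => ENNReal.ofReal (M.dens θ₁ z)))
    (hfar : η < hellingerDist M.baseMeasure (M.dens θ₁) (M.dens θ₀)) (N : ℕ) :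
    ∫⁻ z, M.intRatio θ₀ A z ^ (1 / 2 : ℝ) ∂M.dataLaw θ₀ N ≤ ENNReal.ofReal (1 - η ^ 2 / 2) ^ N := by
  have hη2 : η ^ 2 < 1 := by nlinarith
  have hr1 : r ^ 2 ≤ 1 := by nlinarith
  have hone : ∀ ν : Measure (Σ k, Θ k), SFinite ν → ν Aᶜ = 0 →
      ∫⁻ z, (∫⁻ θ, M.likRatio θ₀ θ z ∂ν) ^ (1 / 2 : ℝ) ∂M.law θ₀
        ≤ ENNReal.ofReal (1 - η ^ 2 / 2) * ν Set.univ ^ (1 / 2 : ℝ) := by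
    intro ν _ hν
    refine (M.lintegral_rpow_half_lintegral_likRatio_le θ₀ ν).trans ?_
    set c := ν Set.univ with hc
    rcases eq_or_ne c 0 with h0 | h0
    · rw [Measure.measure_univ_eq_zero.1 h0]
      simp [affinity]
    rcases eq_or_ne c ⊤ with ht | ht
    · rw [ht, ENNReal.top_rpow_of_pos (by norm_num), ENNReal.mul_top]
      · exact le_top
      · simp only [ne_eq, ENNReal.ofReal_eq_zero, not_le]
        linarith
    have hπ : IsProbabilityMeasure (c⁻¹ • ν) :=
      ⟨by rw [Measure.smul_apply, smul_eq_mul, ← hc, ENNReal.inv_mul_cancel h0 ht]⟩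
    have hνπ : ∀ f : (Σ k, Θ k) → ℝ≥0∞, ∫⁻ θ, f θ ∂ν = c * ∫⁻ θ, f θ ∂(c⁻¹ • ν) := fun f => by
      rw [lintegral_smul_measure, smul_eq_mul, ← mul_assoc, ENNReal.mul_inv_cancel h0 ht, one_mul]
    have hA' : ∀ᵐ θ ∂(c⁻¹ • ν), θ ∈ A := by
      rw [ae_iff]
      change (c⁻¹ • ν) Aᶜ = 0
      simp [hν]
    -- `l = 2 / η ^ 2` makes both error terms `l * r ^ 2` and `1 / (2 * l)` at most `η ^ 2 / 4`
    have hmain := affinity_mixture_le (m := M.baseMeasure) (π := c⁻¹ • ν) (b := η ^ 2)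
      (p := fun θ z => ENNReal.ofReal (M.dens θ z)) M.measurable_dens.ennreal_ofReal
      (M.measurable_dens_apply θ₁).ennreal_ofReal (M.measurable_dens_apply θ₀).ennreal_ofReal
      (Eventually.of_forall M.lintegral_ofReal_dens) (M.lintegral_ofReal_dens θ₁)
      (M.lintegral_ofReal_dens θ₀) hr1 hη2.le (l := 2 / η ^ 2) (by positivity)
      (hA'.mono hclose) (by
        rw [M.affinity_dens_eq]
        refine ENNReal.ofReal_le_ofReal ?_
        nlinarith)
    have hconst : 1 - η ^ 2 + 2 / η ^ 2 * r ^ 2 + 1 / (2 * (2 / η ^ 2)) ≤ 1 - η ^ 2 / 2 := by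
      have h1 : 2 / η ^ 2 * r ^ 2 ≤ 2 / η ^ 2 * (η ^ 4 / 8) := by gcongr
      have h2 : 2 / η ^ 2 * (η ^ 4 / 8) = η ^ 2 / 4 := by field_simp; norm_num
      have h3 : 1 / (2 * (2 / η ^ 2)) = η ^ 2 / 4 := by field_simp; norm_num
      linarith
    calc _ = c ^ (1 / 2 : ℝ) * affinity M.baseMeasure
          (fun z => ∫⁻ θ, ENNReal.ofReal (M.dens θ z) ∂(c⁻¹ • ν))
          (fun z => ENNReal.ofReal (M.dens θ₀ z)) := by
          unfold affinity
          rw [← lintegral_const_mul' _ _ (ENNReal.rpow_ne_top_of_nonneg (by norm_num) ht)]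
          refine lintegral_congr fun z => ?_
          beta_reduce
          rw [hνπ, ENNReal.mul_rpow_of_nonneg _ _ (by norm_num), mul_assoc]
      _ ≤ c ^ (1 / 2 : ℝ) * ENNReal.ofReal (1 - η ^ 2 / 2) := by
          gcongr
          exact hmain.trans (ENNReal.ofReal_le_ofReal hconst)
      _ = _ := mul_comm _ _
  refine (lintegral_rpow_pi_le (M.measurable_likRatio θ₀) hone N (M.prior.restrict A)
    inferInstance (by simp [Measure.restrict_apply hA.compl])).trans ?_
  refine mul_le_of_le_one_right' ?_
  rw [Measure.restrict_apply_univ]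
  exact ENNReal.rpow_le_one prob_le_one (by norm_num)

/-! ### The evidence of the Kullback–Leibler neighborhood -/

theorem measurable_logRatio :
    Measurable (Function.uncurry fun θ z => Real.log (M.dens θ z / M.dens θ₀ z)) :=
  Real.measurable_log.comp
    (M.measurable_dens.div ((M.measurable_dens_apply θ₀).comp measurable_snd))

theorem measurableSet_klNeighborhood (r : ℝ) : MeasurableSet (M.klNeighborhood θ₀ r) := by
  have hlog := M.measurable_logRatio θ₀
  have h1 : MeasurableSet {θ | ∀ᵐ z ∂M.law θ₀, 0 < M.dens θ z} := by
    have hm : MeasurableSet {q : (Σ k, Θ k) × (𝒳 × 𝒴) | ¬ 0 < M.dens q.1 q.2} :=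
      (measurableSet_lt measurable_const M.measurable_dens).compl
    exact measurable_measure_prodMk_left (ν := M.law θ₀) hm (measurableSet_singleton 0)
  have h2 : Measurable fun θ => ∫ z, Real.log (M.dens θ z / M.dens θ₀ z) ∂M.law θ₀ :=
    (StronglyMeasurable.integral_prod_right hlog.stronglyMeasurable).measurable
  have h3 : Measurable fun θ =>
      ∫⁻ z, ENNReal.ofReal (Real.log (M.dens θ z / M.dens θ₀ z) ^ 2) ∂M.law θ₀ :=
    Measurable.lintegral_prod_right (hlog.pow_const 2).ennreal_ofReal
  exact h1.inter ((measurableSet_le h2.neg measurable_const).inter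
    (measurableSet_le h3 measurable_const))

theorem dataLaw_intRatio_lt_le {N : ℕ} {e x t : ℝ} (ht : 0 < t)
    (hx : ENNReal.ofReal (Real.exp (-x)) ≤ M.prior (M.klNeighborhood θ₀ e)) :
    M.dataLaw θ₀ N {z | M.intRatio θ₀ Set.univ z
        < ENNReal.ofReal (Real.exp (-(x + (N * e ^ 2 + t))))}
      ≤ ENNReal.ofReal (N * e ^ 2 / t ^ 2) := by
  set G := M.klNeighborhood θ₀ e with hG
  have hGm : MeasurableSet G := M.measurableSet_klNeighborhood θ₀ e
  set c := M.prior G with hc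
  have h0 : c ≠ 0 := ((ENNReal.ofReal_pos.2 (Real.exp_pos _)).trans_le hx).ne'
  have htop : c ≠ ⊤ := measure_ne_top _ _
  have hπ : IsProbabilityMeasure (c⁻¹ • M.prior.restrict G) :=
    ⟨by rw [Measure.smul_apply, smul_eq_mul, Measure.restrict_apply_univ, ← hc,
      ENNReal.inv_mul_cancel h0 htop]⟩
  have hGπ : ∀ᵐ θ ∂(c⁻¹ • M.prior.restrict G), θ ∈ G :=
    Measure.ae_smul_measure (ae_restrict_mem hGm) _
  refine le_trans (measure_mono_ae ?_) (pi_lintegral_exp_sum_lt_le (μ := M.law θ₀)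
    (M.measurable_logRatio θ₀) (sq_nonneg e) ht (hGπ.mono fun θ hθ => hθ.2.1)
    (hGπ.mono fun θ hθ => hθ.2.2) N)
  -- a vanishing density would make the real logarithm a junk value, so positivity is needed
  -- for almost all parameters of the neighborhood simultaneously
  have hpos : ∀ᵐ z ∂M.law θ₀, ∀ᵐ θ ∂M.prior.restrict G, 0 < M.dens θ z := by
    have hm : MeasurableSet {q : (Σ k, Θ k) × (𝒳 × 𝒴) | 0 < M.dens q.1 q.2} :=
      measurableSet_lt measurable_const M.measurable_dens
    rw [← Measure.ae_ae_comm hm]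
    exact (ae_restrict_mem hGm).mono fun θ hθ => hθ.1
  filter_upwards [M.ae_dataLaw_of_ae_law hpos N, M.ae_dataLaw_of_ae_law (M.ae_dens_pos θ₀) N]
    with z hz hz₀ hlt
  have hGz : M.intRatio θ₀ G z
      = ∫⁻ θ in G, ENNReal.ofReal (Real.exp
          (∑ i, Real.log (M.dens θ (z i) / M.dens θ₀ (z i)))) ∂M.prior := by
    refine lintegral_congr_ae ?_
    filter_upwards [ae_all_iff.2 hz] with θ hθ
    rw [Real.exp_sum, ENNReal.ofReal_prod_of_nonneg fun i _ => (Real.exp_pos _).le]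
    refine Finset.prod_congr rfl fun i _ => ?_
    rw [Real.exp_log (div_pos (hθ i) (hz₀ i)), likRatio]
  change ∫⁻ θ, _ ∂(c⁻¹ • M.prior.restrict G) < _
  rw [lintegral_smul_measure, smul_eq_mul, ← hGz, mul_comm, ← div_eq_mul_inv]
  refine ENNReal.div_lt_of_lt_mul ?_
  calc M.intRatio θ₀ G z ≤ M.intRatio θ₀ Set.univ z := M.intRatio_mono θ₀ (Set.subset_univ _) z
    _ < ENNReal.ofReal (Real.exp (-(x + (N * e ^ 2 + t)))) := hlt
    _ = ENNReal.ofReal (Real.exp (-(N * e ^ 2 + t))) * ENNReal.ofReal (Real.exp (-x)) := by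
        rw [← ENNReal.ofReal_mul (Real.exp_pos _).le, ← Real.exp_add]
        congr 2
        ring
    _ ≤ _ := by gcongr

/-! ### Posterior concentration at a fixed sample size -/

/-- The neighborhood of radius `e`, and the sieve `S` with its packing radius `r`, need not belong
to the sample size `N`; this freedom is what yields the constant `1 / C ^ 2`. -/
theorem dataLaw_modelProb_lt_le_of_sieve {N : ℕ} {k : Fin K} {δ C b e r η : ℝ} (hδ : 0 < δ)
    (hb : 0 < b) (hNe : N * e ^ 2 ≤ b)
    (hG : ENNReal.ofReal (Real.exp (-(b * C))) ≤ M.prior (M.klNeighborhood θ₀ e))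
    {S : Set (Σ k, Θ k)} (hS : M.prior Sᶜ ≤ ENNReal.ofReal (Real.exp (-(b * (C + 4)))))
    (hpack : (packingNumber (hellingerDist M.baseMeasure) r (M.densSet S) : ℝ≥0∞)
      ≤ ENNReal.ofReal (Real.exp b))
    (hr : 0 < r) (hη : 0 < η) (hη1 : η < 1) (hrη : r ^ 2 ≤ η ^ 4 / 8)
    (hsep : ∀ θ : Σ k, Θ k, θ.1 ≠ k → η < hellingerDist M.baseMeasure (M.dens θ) (M.dens θ₀))
    (hN : b * (3 + C / 2) ≤ N * η ^ 2 / 2) :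
    (M.dataLaw θ₀ N).real {z | M.modelProb z k < 1 - δ}
      ≤ N * e ^ 2 / b ^ 2 + (Real.exp (-(2 * b)) + Real.exp (-b)) / δ := by
  -- `S` need not be measurable, so its complement is replaced by a measurable hull
  set T := toMeasurable M.prior Sᶜ with hT
  have hTS : Tᶜ ⊆ S := Set.compl_subset_comm.1 (subset_toMeasurable M.prior Sᶜ)
  have hTle : M.prior T ≤ ENNReal.ofReal (Real.exp (-(b * (C + 4)))) := by
    rwa [hT, measure_toMeasurable]
  set W : Set (Σ k, Θ k) := {θ | θ.1 ≠ k ∧ θ ∉ T} with hW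
  obtain ⟨B, hBW, hBcard, hBnet⟩ := exists_net_encard_le_packingNumber
    (hellingerDist_comm M.baseMeasure) (r := r) (X := M.dens '' W) (A := M.densSet S)
    (Set.image_mono fun θ hθ => hTS hθ.2)
  have hBle : (B.encard : ℝ≥0∞) ≤ ENNReal.ofReal (Real.exp b) :=
    le_trans (by exact_mod_cast hBcard) hpack
  have hBfin : B.Finite := by
    rw [← Set.encard_ne_top_iff]
    rintro h
    rw [h] at hBle
    exact ENNReal.ofReal_ne_top (top_le_iff.1 hBle)
  set A : (𝒳 × 𝒴 → ℝ) → Set (Σ k, Θ k) := fun q => {θ | ENNReal.ofReal (1 - r ^ 2) ≤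
    affinity M.baseMeasure (fun z => ENNReal.ofReal (M.dens θ z))
      (fun z => ENNReal.ofReal (q z))} with hA
  have hcover : {θ : Σ k, Θ k | θ.1 ≠ k} ⊆ T ∪ ⋃ q ∈ hBfin.toFinset, A q := by
    intro θ hθ
    by_cases hθT : θ ∈ T
    · exact Or.inl hθT
    obtain ⟨q, hqB, hq⟩ : ∃ q ∈ B, hellingerDist M.baseMeasure (M.dens θ) q < r := by
      rcases hBnet _ (Set.mem_image_of_mem M.dens (show θ ∈ W from ⟨hθ, hθT⟩)) with h | h
      · exact ⟨_, h, by simpa [hellingerDist] using hr⟩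
      · exact h
    refine Or.inr (Set.mem_biUnion (show q ∈ (hBfin.toFinset : Set _) by simpa using hqB) ?_)
    obtain ⟨θ₁, -, rfl⟩ := hBW hqB
    change _ ≤ affinity _ _ _
    rw [M.affinity_dens_eq]
    refine ENNReal.ofReal_le_ofReal ?_
    have : 0 ≤ hellingerDist M.baseMeasure (M.dens θ) (M.dens θ₁) := Real.sqrt_nonneg _
    nlinarith
  have hcell : ∀ q ∈ hBfin.toFinset, ∫⁻ z, M.intRatio θ₀ (A q) z ^ (1 / 2 : ℝ) ∂M.dataLaw θ₀ N
      ≤ ENNReal.ofReal (Real.exp (-(N * η ^ 2 / 2))) := by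
    intro q hq
    obtain ⟨θ₁, hθ₁, rfl⟩ := hBW (hBfin.mem_toFinset.1 hq)
    have hAm : MeasurableSet (A (M.dens θ₁)) := by
      refine measurableSet_le measurable_const (Measurable.lintegral_prod_right ?_)
      exact (M.measurable_dens.ennreal_ofReal.pow_const _).mul
        (((M.measurable_dens_apply θ₁).comp measurable_snd).ennreal_ofReal.pow_const _)
    refine (M.lintegral_intRatio_rpow_half_le θ₀ hAm hη hη1 hrη (fun θ hθ => hθ)
      (hsep θ₁ hθ₁.1) N).trans ?_
    rw [← ENNReal.ofReal_pow (by nlinarith)]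
    refine ENNReal.ofReal_le_ofReal ?_
    calc (1 - η ^ 2 / 2) ^ N ≤ Real.exp (-(η ^ 2 / 2)) ^ N := by
          gcongr
          · nlinarith
          · exact Real.one_sub_le_exp_neg _
      _ = Real.exp (-(N * η ^ 2 / 2)) := by
          rw [← Real.exp_nat_mul]
          congr 1
          ring
  set c := ENNReal.ofReal (Real.exp (-(b * (C + 2)))) with hc
  have hc0 : c ≠ 0 := (ENNReal.ofReal_pos.2 (Real.exp_pos _)).ne'
  have hevid : M.dataLaw θ₀ N {z | M.intRatio θ₀ Set.univ z < c}
      ≤ ENNReal.ofReal (N * e ^ 2 / b ^ 2) := by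
    refine (measure_mono fun z hz => ?_).trans (M.dataLaw_intRatio_lt_le θ₀ hb hG)
    refine lt_of_lt_of_le hz (ENNReal.ofReal_le_ofReal (Real.exp_le_exp.2 ?_))
    linarith
  have hTc : M.prior T / c ≤ ENNReal.ofReal (Real.exp (-(2 * b))) := by
    refine ENNReal.div_le_of_le_mul (hTle.trans (le_of_eq ?_))
    rw [hc, ← ENNReal.ofReal_mul (Real.exp_pos _).le, ← Real.exp_add]
    congr 2
    ring
  have hsum : ∑ q ∈ hBfin.toFinset,
      (∫⁻ z, M.intRatio θ₀ (A q) z ^ (1 / 2 : ℝ) ∂M.dataLaw θ₀ N) / c ^ (1 / 2 : ℝ)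
        ≤ ENNReal.ofReal (Real.exp (-b)) := by
    have hchalf : c ^ (1 / 2 : ℝ) = ENNReal.ofReal (Real.exp (-(b * (C + 2) / 2))) := by
      rw [hc, ENNReal.ofReal_rpow_of_pos (Real.exp_pos _), ← Real.exp_mul]
      congr 2
      ring
    calc _ ≤ ∑ q ∈ hBfin.toFinset,
          ENNReal.ofReal (Real.exp (-(N * η ^ 2 / 2))) / c ^ (1 / 2 : ℝ) :=
          Finset.sum_le_sum fun q hq => ENNReal.div_le_div_right (hcell q hq) _
      _ = (B.encard : ℝ≥0∞)
          * (ENNReal.ofReal (Real.exp (-(N * η ^ 2 / 2))) / c ^ (1 / 2 : ℝ)) := by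
          rw [Finset.sum_const, nsmul_eq_mul, hBfin.encard_eq_coe_toFinset_card]
          simp
      _ ≤ ENNReal.ofReal (Real.exp b)
          * (ENNReal.ofReal (Real.exp (-(N * η ^ 2 / 2))) / c ^ (1 / 2 : ℝ)) := by gcongr
      _ = ENNReal.ofReal (Real.exp (b - N * η ^ 2 / 2 + b * (C + 2) / 2)) := by
          rw [hchalf, ← ENNReal.ofReal_div_of_pos (Real.exp_pos _),
            ← ENNReal.ofReal_mul (Real.exp_pos _).le, ← Real.exp_sub, ← Real.exp_add]
          congr 2
          ring
      _ ≤ _ := ENNReal.ofReal_le_ofReal (Real.exp_le_exp.2 (by linarith))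
  refine ENNReal.toReal_le_of_le_ofReal (by positivity) ?_
  refine (M.dataLaw_modelProb_lt_le θ₀ hδ hc0 hBfin.toFinset T A hcover).trans ?_
  rw [ENNReal.ofReal_add (by positivity) (by positivity), ENNReal.ofReal_div_of_pos hδ,
    ENNReal.ofReal_add (Real.exp_pos _).le (Real.exp_pos _).le]
  gcongr

/-! ### Asymptotics -/

/-- The evidence for `N` observations is bounded below with the Kullback–Leibler neighborhood that
belongs to the sample size `A * N`, where `A ≥ C ^ 2`; its log-likelihood ratios have a variance
smaller by the factor `A`.  The sieve is that of whichever of `N` and `A * N` has the larger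
`n * ε n ^ 2`. -/
theorem eventually_dataLaw_modelProb_lt_le (k : Fin K) {ε : ℕ → ℝ} {C : ℝ}
    {S : ℕ → Set (Σ k, Θ k)} (hC : 0 < C) (hε : ∀ᶠ N in atTop, 0 < ε N)
    (hε0 : Tendsto ε atTop (𝓝 0))
    (hpack : ∀ᶠ N : ℕ in atTop,
      (packingNumber (hellingerDist M.baseMeasure) (ε N / 2) (M.densSet (S N)) : ℝ≥0∞)
        ≤ ENNReal.ofReal (Real.exp (N * ε N ^ 2)))
    (hS : ∀ᶠ N : ℕ in atTop,
      M.prior (S N)ᶜ ≤ ENNReal.ofReal (Real.exp (-(N * ε N ^ 2 * (C + 4)))))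
    (hG : ∀ᶠ N : ℕ in atTop, ENNReal.ofReal (Real.exp (-(N * ε N ^ 2 * C)))
      ≤ M.prior (M.klNeighborhood θ₀ (ε N)))
    {η : ℝ} (hη : 0 < η)
    (hsep : ∀ θ : Σ k, Θ k, θ.1 ≠ k → η < hellingerDist M.baseMeasure (M.dens θ) (M.dens θ₀))
    {δ : ℝ} (hδ : 0 < δ) (hδ1 : δ ≤ 1) :
    ∀ᶠ N : ℕ in atTop, (M.dataLaw θ₀ N).real {z | M.modelProb z k < 1 - δ}
      ≤ 1 / (C ^ 2 * N * ε N ^ 2 * δ) + 2 * Real.exp (-(1 * N * ε N ^ 2)) / δ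
        + 2 * Real.exp (-(2 * N * ε N ^ 2)) / δ := by
  wlog hη1 : η < 1 generalizing η
  · exact this (η := 1 / 2) (by norm_num)
      (fun θ hθ => lt_trans (by linarith) (hsep θ hθ)) (by norm_num)
  obtain ⟨A, hA⟩ := exists_nat_ge (max 1 (C ^ 2))
  have hA1 : (1 : ℝ) ≤ A := (le_max_left _ _).trans hA
  have hAC : C ^ 2 ≤ A := (le_max_right _ _).trans hA
  have hA1' : 1 ≤ A := by exact_mod_cast hA1
  have hsq : Tendsto (fun N => ε N ^ 2) atTop (𝓝 0) := by simpa using hε0.pow 2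
  have hsmall : ∀ᶠ N in atTop, ε N ^ 2 ≤ η ^ 4 / 2 :=
    hsq.eventually_le_const (by positivity)
  have hsmall' : ∀ᶠ N in atTop, A * (ε N ^ 2 * (3 + C / 2)) ≤ η ^ 2 / 2 := by
    have : Tendsto (fun N => A * (ε N ^ 2 * (3 + C / 2))) atTop (𝓝 0) := by
      simpa using (hsq.mul_const (3 + C / 2)).const_mul (A : ℝ)
    exact this.eventually_le_const (by positivity)
  have hall := hε.and (hpack.and (hS.and (hG.and (hsmall.and hsmall'))))
  have hmul : Tendsto (fun N => A * N) atTop atTop :=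
    tendsto_atTop_mono (fun N => Nat.le_mul_of_pos_left N hA1') tendsto_id
  filter_upwards [hall, hmul.eventually hall, eventually_ge_atTop 1] with N h h' hN1
  have hN0 : (0 : ℝ) < N := by exact_mod_cast hN1
  -- `n` is the index with the larger `n * ε n ^ 2`
  obtain ⟨n, hnA, ⟨hεn, hpn, hSn, -, hsn, hsn'⟩, hle, hle'⟩ : ∃ n : ℕ, (n : ℝ) ≤ A * N ∧
      (0 < ε n ∧
        (packingNumber (hellingerDist M.baseMeasure) (ε n / 2) (M.densSet (S n)) : ℝ≥0∞)
          ≤ ENNReal.ofReal (Real.exp (n * ε n ^ 2)) ∧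
        M.prior (S n)ᶜ ≤ ENNReal.ofReal (Real.exp (-(n * ε n ^ 2 * (C + 4)))) ∧
        ENNReal.ofReal (Real.exp (-(n * ε n ^ 2 * C))) ≤ M.prior (M.klNeighborhood θ₀ (ε n)) ∧
        ε n ^ 2 ≤ η ^ 4 / 2 ∧ A * (ε n ^ 2 * (3 + C / 2)) ≤ η ^ 2 / 2) ∧
      N * ε N ^ 2 ≤ n * ε n ^ 2 ∧ ((A * N : ℕ) : ℝ) * ε (A * N) ^ 2 ≤ n * ε n ^ 2 := by
    rcases le_total (((A * N : ℕ) : ℝ) * ε (A * N) ^ 2) (N * ε N ^ 2) with hcase | hcase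
    · exact ⟨N, le_mul_of_one_le_left hN0.le hA1, h, le_rfl, hcase⟩
    · exact ⟨A * N, by push_cast; exact le_rfl, h', hcase, le_rfl⟩
  have ha : 0 < N * ε N ^ 2 := by have := h.1; positivity
  set b := n * ε n ^ 2 with hb
  have hb0 : 0 < b := ha.trans_le hle
  push_cast at hle'
  have hAe : A * (N * ε (A * N) ^ 2) ≤ b := by linarith
  have hNe : N * ε (A * N) ^ 2 ≤ b := by
    have : 0 ≤ N * ε (A * N) ^ 2 := by positivity
    nlinarith
  have hGb : ENNReal.ofReal (Real.exp (-(b * C))) ≤ M.prior (M.klNeighborhood θ₀ (ε (A * N))) := by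
    refine le_trans (ENNReal.ofReal_le_ofReal (Real.exp_le_exp.2 ?_)) h'.2.2.2.1
    push_cast
    gcongr
  have hNb : b * (3 + C / 2) ≤ N * η ^ 2 / 2 := by
    calc b * (3 + C / 2) = n * (ε n ^ 2 * (3 + C / 2)) := by rw [hb]; ring
      _ ≤ A * N * (ε n ^ 2 * (3 + C / 2)) := by gcongr
      _ = N * (A * (ε n ^ 2 * (3 + C / 2))) := by ring
      _ ≤ N * (η ^ 2 / 2) := by gcongr
      _ = _ := by ring
  have hmain := M.dataLaw_modelProb_lt_le_of_sieve θ₀ (r := ε n / 2) hδ hb0 hNe hGb hSn hpn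
    (by positivity) hη hη1 (by linarith) hsep hNb
  have hvar : N * ε (A * N) ^ 2 / b ^ 2 ≤ 1 / (C ^ 2 * N * ε N ^ 2 * δ) := by
    rw [div_le_div_iff₀ (by positivity) (by have := h.1; positivity)]
    calc N * ε (A * N) ^ 2 * (C ^ 2 * N * ε N ^ 2 * δ)
        = (C ^ 2 * (N * ε (A * N) ^ 2)) * (N * ε N ^ 2 * δ) := by ring
      _ ≤ (A * (N * ε (A * N) ^ 2)) * (N * ε N ^ 2 * 1) := by gcongr
      _ ≤ b * (b * 1) := by gcongr
      _ = 1 * b ^ 2 := by ring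
  have hexp1 : Real.exp (-b) ≤ 2 * Real.exp (-(1 * N * ε N ^ 2)) := by
    have := Real.exp_le_exp.2 (show -b ≤ -(1 * N * ε N ^ 2) by linarith)
    linarith [Real.exp_pos (-(1 * N * ε N ^ 2))]
  have hexp2 : Real.exp (-(2 * b)) ≤ 2 * Real.exp (-(2 * N * ε N ^ 2)) := by
    have := Real.exp_le_exp.2 (show -(2 * b) ≤ -(2 * N * ε N ^ 2) by linarith)
    linarith [Real.exp_pos (-(2 * N * ε N ^ 2))]
  calc _ ≤ _ := hmain
    _ = N * ε (A * N) ^ 2 / b ^ 2 + Real.exp (-b) / δ + Real.exp (-(2 * b)) / δ := by ring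
    _ ≤ _ := by gcongr

end BayesModel

/-- The true model is the one with index `0 : Fin K`, and `θ₀` is the true parameter. -/
theorem theorem2 :
    ∃ L : ℝ, 0 < L ∧
      ∀ (K : ℕ) [NeZero K] (Θ : Fin K → Type u) [∀ k, MeasurableSpace (Θ k)]
        (𝒳 : Type v) [MeasurableSpace 𝒳] (𝒴 : Type w) [MeasurableSpace 𝒴]
        (M : BayesModel K Θ 𝒳 𝒴) (θ₀ : Σ k, Θ k) (_ : θ₀.1 = 0)
        (ε : ℕ → ℝ) (C : ℝ) (S : ℕ → Set (Σ k, Θ k)),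
        0 < C →
        (∀ᶠ N in atTop, 0 < ε N) →
        Tendsto ε atTop (𝓝 0) →
        Tendsto (fun N : ℕ => (N : ℝ) * ε N ^ 2) atTop atTop →
        -- the entropy condition
        (∀ᶠ N : ℕ in atTop,
          (packingNumber (hellingerDist M.baseMeasure) (ε N / 2) (M.densSet (S N)) : ℝ≥0∞)
            ≤ ENNReal.ofReal (Real.exp (N * ε N ^ 2))) →
        -- the prior mass outside the sieve
        (∀ᶠ N : ℕ in atTop,
          M.prior (S N)ᶜ ≤ ENNReal.ofReal (Real.exp (-(N * ε N ^ 2 * (C + 4))))) →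
        -- the prior mass near the truth
        (∀ᶠ N : ℕ in atTop,
          ENNReal.ofReal (Real.exp (-(N * ε N ^ 2 * C)))
            ≤ M.prior (M.klNeighborhood θ₀ (ε N))) →
        -- the wrong models are separated from the truth
        (∃ η : ℝ, 0 < η ∧ ∀ θ : Σ k, Θ k, θ.1 ≠ 0 →
          η < hellingerDist M.baseMeasure (M.dens θ) (M.dens θ₀)) →
        (∀ δ : ℝ, 0 < δ → δ < 1 → ∀ᶠ N : ℕ in atTop,
          (M.dataLaw θ₀ N).real {z | M.modelProb z 0 < 1 - δ}
            ≤ 1 / (C ^ 2 * N * ε N ^ 2 * δ)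
              + 2 * Real.exp (-(L * N * ε N ^ 2)) / δ
              + 2 * Real.exp (-(2 * N * ε N ^ 2)) / δ) ∧
        (∀ δ : ℝ, 0 < δ → δ < 1 → ∀ᶠ N : ℕ in atTop,
          (M.dataLaw θ₀ N).real
              {z | δ < dist (WithLp.toLp 2 (M.modelProb z) : EuclideanSpace ℝ (Fin K))
                (EuclideanSpace.single 0 1)}
            ≤ √2 / (C ^ 2 * N * ε N ^ 2 * δ)
              + 2 * √2 * Real.exp (-(L * N * ε N ^ 2)) / δ
              + 2 * √2 * Real.exp (-(2 * N * ε N ^ 2)) / δ) ∧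
        (∀ δ : ℝ, 0 < δ → δ < √((√2 - 1) ^ 2 + 1) / 2 → ∀ᶠ N : ℕ in atTop,
          (M.dataLaw θ₀ N).real
              {z | δ < hellingerDistVec (M.modelProb z) (Pi.single 0 1)}
            ≤ ((√2 - 1) ^ 2 + 1) / (√2 * C ^ 2 * N * ε N ^ 2 * δ ^ 2)
              + ((√2 - 1) ^ 2 + 1) * Real.exp (-(L * N * ε N ^ 2)) / δ ^ 2
              + ((√2 - 1) ^ 2 + 1) * Real.exp (-(2 * N * ε N ^ 2)) / δ ^ 2) := by
  refine ⟨1, one_pos, ?_⟩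
  intro K _ Θ _ 𝒳 _ 𝒴 _ M θ₀ _ ε C S hC hε hε0 _ hpack hS hG ⟨η, hη, hsep⟩
  have key : ∀ δ : ℝ, 0 < δ → δ ≤ 1 → ∀ᶠ N : ℕ in atTop,
      (M.dataLaw θ₀ N).real {z | M.modelProb z 0 < 1 - δ}
        ≤ 1 / (C ^ 2 * N * ε N ^ 2 * δ) + 2 * Real.exp (-(1 * N * ε N ^ 2)) / δ
          + 2 * Real.exp (-(2 * N * ε N ^ 2)) / δ := fun δ hδ hδ1 =>
    M.eventually_dataLaw_modelProb_lt_le θ₀ 0 hC hε hε0 hpack hS hG hη hsep hδ hδ1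
  refine ⟨fun δ hδ hδ1 => key δ hδ hδ1.le, fun δ hδ hδ1 => ?_, fun δ hδ hδ1 => ?_⟩
  · have h2 : 0 < √2 := by positivity
    have h12 : 1 ≤ √2 := Real.one_le_sqrt.2 (by norm_num)
    filter_upwards [key (δ / √2) (by positivity) ((div_le_one h2).2 (by linarith))] with N hN
    refine (measureReal_mono fun z hz => ?_).trans (hN.trans (le_of_eq ?_))
    · have hd := hz.out.trans_le
        (dist_single_le (M.modelProb z) 0 (M.modelProb_nonneg z) (M.sum_modelProb_le z))
      have : δ / √2 < 1 - M.modelProb z 0 := by rwa [div_lt_iff₀' h2]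
      simp only [Set.mem_ofPred_eq]
      linarith
    · simp only [div_eq_mul_inv, mul_inv, inv_inv]
      ring
  · have h2 : √2 ^ 2 = 2 := Real.sq_sqrt (by norm_num)
    have h21 : 1.414 < √2 := Real.lt_sqrt_of_sq_lt (by norm_num)
    have h22 : √2 < 1.415 := (Real.sqrt_lt' (by norm_num)).2 (by norm_num)
    have hδsq : δ ^ 2 < ((√2 - 1) ^ 2 + 1) / 4 := by
      have := pow_lt_pow_left₀ hδ1 hδ.le two_ne_zero
      rw [div_pow, Real.sq_sqrt (by positivity)] at this
      linarith
    -- `((√2 - 1) ^ 2 + 1) / 4 = 1 - √2 / 2` is the threshold at which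
    -- `2 / (2 - δ ^ 2) = (√2 - 1) ^ 2 + 1`
    have hκ : (√2 - 1) ^ 2 + 1 = 4 - 2 * √2 := by linear_combination h2
    have hδ2 : 0 < 2 - δ ^ 2 := by linarith
    have hδ0 : 0 < δ ^ 2 := by positivity
    -- `1 - δ ^ 2 * (2 - δ ^ 2) = (1 - δ ^ 2) ^ 2`
    filter_upwards [key (δ ^ 2 * (2 - δ ^ 2)) (by positivity)
      (by nlinarith [sq_nonneg (δ ^ 2 - 1)])] with N hN
    refine (measureReal_mono fun z hz => ?_).trans (hN.trans ?_)
    · have hd := hellingerDistVec_single_sq_le (M.modelProb z) 0 (M.modelProb_nonneg z)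
        (M.sum_modelProb_le z)
      have h1 : δ ^ 2 < hellingerDistVec (M.modelProb z) (Pi.single 0 1) ^ 2 :=
        pow_lt_pow_left₀ hz.out hδ.le two_ne_zero
      have h3 : √(M.modelProb z 0) < 1 - δ ^ 2 := by linarith
      have h4 := Real.sq_sqrt (M.modelProb_nonneg z 0)
      have h5 := Real.sqrt_nonneg (M.modelProb z 0)
      simp only [Set.mem_ofPred_eq]
      nlinarith
    · have hexp : ∀ x : ℝ, 2 * Real.exp x / (δ ^ 2 * (2 - δ ^ 2))
          ≤ ((√2 - 1) ^ 2 + 1) * Real.exp x / δ ^ 2 := fun x => by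
        have h3 : 2 / (2 - δ ^ 2) ≤ (√2 - 1) ^ 2 + 1 := by
          rw [div_le_iff₀ hδ2, hκ]
          nlinarith
        calc 2 * Real.exp x / (δ ^ 2 * (2 - δ ^ 2))
            = 2 / (2 - δ ^ 2) * (Real.exp x / δ ^ 2) := by field_simp
          _ ≤ ((√2 - 1) ^ 2 + 1) * (Real.exp x / δ ^ 2) := by gcongr
          _ = _ := by ring
      have hpoly : 1 / (C ^ 2 * N * ε N ^ 2 * (δ ^ 2 * (2 - δ ^ 2)))
          ≤ ((√2 - 1) ^ 2 + 1) / (√2 * C ^ 2 * N * ε N ^ 2 * δ ^ 2) := by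
        have h3 : 1 / (2 - δ ^ 2) ≤ ((√2 - 1) ^ 2 + 1) / √2 := by
          rw [div_le_div_iff₀ hδ2 (by positivity), hκ]
          nlinarith
        calc 1 / (C ^ 2 * N * ε N ^ 2 * (δ ^ 2 * (2 - δ ^ 2)))
            = 1 / (2 - δ ^ 2) * (1 / (C ^ 2 * N * ε N ^ 2 * δ ^ 2)) := by
              rw [div_mul_div_comm]; congr 1 <;> ring
          _ ≤ ((√2 - 1) ^ 2 + 1) / √2 * (1 / (C ^ 2 * N * ε N ^ 2 * δ ^ 2)) := by gcongr
          _ = _ := by rw [div_mul_div_comm]; congr 1 <;> ring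
      exact add_le_add (add_le_add hpoly (hexp _)) (hexp _)
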